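/- **Conventions.** Categories have a set of morphisms between any two objects; compositions of $1$-cells and of pseudofunctors are written in diagrammatic order. A category is *univalent* if, for all objects $x,y$, the map from identities $x=y$ to isomorphisms $x\cong y$ is an equivalence. The result holds for both readings of this condition: the homotopical one, in which an identity of two objects *is* an isomorphism (so that every category, considered up to equivalence, is univalent and the condition is vacuous), and the literal one, in which an identity is an equality of elements of the set of objects. Fix one of the two readings throughout. **Finite limits.** $\mathsf{FinLim}$ is the bicategory of univalent categories with finite limits, functors that preserve finite limits, and natural transformations. **Comprehension categories.** A *comprehension category* consists of a category $\mathcal C$ (of contexts) with a terminal object $\top$, a displayed category $\mathcal D$ over $\mathcal C$ (of types) that is a fibration, and a Cartesian displayed functor $\chi:\mathcal D\to\mathrm{Arr}\,\mathcal C$ over the identity of $\mathcal C$, where $\mathrm{Arr}\,\mathcal C$ is the arrow category, displayed over $\mathcal C$ by codomains. For $A\in\mathcal D_\Gamma$ write $\pi_A:\Gamma.A\to\Gamma$ for $\chi(A)$, and $s^*:\mathcal D_\Delta\to\mathcal D_\Gamma$ for reindexing of fibre categories along $s:\Gamma\to\Delta$. The comprehension category is *full* if $\chi$ is fully faithful,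 and *univalent* if $\mathcal C$ and all fibre categories $\mathcal D_\Gamma$ are univalent. A *DFL comprehension category* is a full univalent comprehension category such that: 1. (strong unit types) the fibre categories have terminal objects, preserved by all $s^*$, and $\pi_{1}$ is invertible for every terminal object $1$ of every $\mathcal D_\Gamma$; 2. (binary product types, equalizer types) the fibre categories have binary products and equalizers, preserved by all $s^*$; 3. (strong $\Sigma$-types) every $\pi_A^*:\mathcal D_\Gamma\to\mathcal D_{\Gamma.A}$ has a left adjoint $\Sigma_A$, with unit $\eta$; the Beck–Chevalley condition holds, i.e. for every pullback square with sides $\pi_{A_1},\pi_{A_2}$, $s:\Gamma_1\to\Gamma_2$ and $t:\Gamma_1.A_1\to\Gamma_2.A_2$ the canonical morphisms $\Sigma_{A_1}t^*B\to s^*\Sigma_{A_2}B$ are invertible; and for all $B\in\mathcal D_{\Gamma.A}$ the morphism $\Gamma.A.B\to\Gamma.\Sigma_AB$ induced by $\eta_B:B\to\pi_A^*\Sigma_AB$ followed by the Cartesian morphism $\pi_A^*\Sigma_AB\to\Sigma_AB$ is invertible; 4. (democracy) every $\Gamma\in\mathcal C$ is isomorphic to $\top.A$ for some $A\in\mathcal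 D_\top$. $\mathsf{DFLCompCat}$ is the bicategory whose objects are the DFL comprehension categories. A $1$-cell from $(\mathcal C_1,\mathcal D_1,\chi_1)$ to $(\mathcal C_2,\mathcal D_2,\chi_2)$ is a triple $(F,\overline F,F_\chi)$ of a functor $F:\mathcal C_1\to\mathcal C_2$ that preserves terminal objects, a Cartesian displayed functor $\overline F:\mathcal D_1\to\mathcal D_2$ over $F$ whose fibre functors preserve terminal objects, binary products and equalizers, and an invertible displayed natural transformation $F_\chi:\mathrm{Arr}(F)\circ\chi_1\Rightarrow\chi_2\circ\overline F$ over the identity. A $2$-cell $(F,\overline F,F_\chi)\Rightarrow(G,\overline G,G_\chi)$ is a pair of a natural transformation $\tau:F\Rightarrow G$ and a displayed natural transformation $\overline\tau:\overline F\Rightarrow\overline G$ over $\tau$ that is compatible with $F_\chi$ and $G_\chi$, i.e. $\chi_2(\overline\tau_A)\circ F_{\chi,A}=G_{\chi,A}\circ\mathrm{Arr}(\tau)_{\chi_1(A)}$. **Theorem.** The following are well defined. - A pseudofunctor $H:\mathsf{FinLim}\to\mathsf{DFLCompCat}$ that sends $\mathcal C$ to $\mathrm{id}:\mathrm{Arr}\,\mathcal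 C\to\mathrm{Arr}\,\mathcal C$, a functor $F$ to $(F,\mathrm{Arr}(F),\mathrm{id})$, and $\tau$ to $(\tau,\mathrm{Arr}(\tau))$. - A pseudofunctor $U:\mathsf{DFLCompCat}\to\mathsf{FinLim}$ that sends $(\mathcal C,\mathcal D,\chi)$ to its category of contexts $\mathcal C$, $(F,\overline F,F_\chi)$ to $F$, and $(\tau,\overline\tau)$ to $\tau$. - A pseudotransformation $\xi:H\cdot U\Rightarrow\mathrm{id}_{\mathsf{FinLim}}$ whose components and naturality $2$-cells are identities. - A pseudotransformation $\zeta:\mathrm{id}_{\mathsf{DFLCompCat}}\Rightarrow U\cdot H$ whose component at $(\mathcal C,\mathcal D,\chi)$ is $(\mathrm{id}_{\mathcal C},\chi,\mathrm{id})$ and whose naturality $2$-cell at $(F,\overline F,F_\chi)$ is given by the identity of $F$ and (the inverse of) $F_\chi$. Both $\xi$ and $\zeta$ are pointwise adjoint equivalences, and they are adjoint equivalences in the bicategories of pseudofunctors, pseudotransformations and modifications. Hence $H$, $U$, $\zeta$ and $\xi$ form a biequivalence between $\mathsf{FinLim}$ and $\mathsf{DFLCompCat}$. -/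

import Mathlib

open CategoryTheory Category Limits Bicategory

universe w v u w₁ v₁ u₁ w₂ v₂ u₂

namespace DFL

set_option linter.checkUnivs false

/-! ## Subbicategories -/

section SubBicategory

variable {B : Type u} [Bicategory.{w, v} B]

/-- A property of objects and a property of 1-cells of a bicategory, the latter closed under
identities and composition. -/
structure SubData (B : Type u) [Bicategory.{w, v} B] where
  P : B → Prop
  Q : ∀ {x y : B}, (x ⟶ y) → Prop
  Q_id : ∀ x : B, Q (𝟙 x)
  Q_comp : ∀ {x y z : B} (f : x ⟶ y) (g : y ⟶ z), Q f → Q g → Q (f ≫ g)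

/-- The objects of the subbicategory determined by `S`. -/
structure Sub (S : SubData B) where
  obj : B
  prop : S.P obj

namespace Sub

variable {S : SubData B}

/-- The 1-cells of the subbicategory determined by `S`. -/
structure Hom (X Y : Sub S) where
  hom : X.obj ⟶ Y.obj
  prop : S.Q hom

instance : Quiver (Sub S) where
  Hom X Y := Hom X Y

instance : CategoryStruct (Sub S) where
  id X := Hom.mk (𝟙 X.obj) (S.Q_id _)
  comp f g := Hom.mk (f.hom ≫ g.hom) (S.Q_comp _ _ f.prop g.prop)

/-- The 2-cells of the subbicategory determined by `S`: all 2-cells of the ambient bicategory. -/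
structure Hom₂ {X Y : Sub S} (f g : X ⟶ Y) where
  hom : f.hom ⟶ g.hom

instance (X Y : Sub S) : Quiver (X ⟶ Y) where
  Hom f g := Hom₂ f g

theorem hom₂_ext {X Y : Sub S} {f g : X ⟶ Y} {σ ρ : f ⟶ g} (h : σ.hom = ρ.hom) : σ = ρ := by
  obtain ⟨σ⟩ := σ
  obtain ⟨ρ⟩ := ρ
  exact congrArg Hom₂.mk h

instance homCategory (X Y : Sub S) : Category (X ⟶ Y) where
  id f := Hom₂.mk (𝟙 f.hom)
  comp σ ρ := Hom₂.mk (σ.hom ≫ ρ.hom)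
  id_comp σ := hom₂_ext (Category.id_comp σ.hom)
  comp_id σ := hom₂_ext (Category.comp_id σ.hom)
  assoc σ ρ κ := hom₂_ext (Category.assoc σ.hom ρ.hom κ.hom)

@[simp] theorem id_hom (X : Sub S) : Hom.hom (𝟙 X) = 𝟙 X.obj := rfl
@[simp] theorem comp_hom {X Y Z : Sub S} (f : X ⟶ Y) (g : Y ⟶ Z) :
    Hom.hom (f ≫ g) = f.hom ≫ g.hom := rfl
@[simp] theorem id₂_hom {X Y : Sub S} (f : X ⟶ Y) : Hom₂.hom (𝟙 f) = 𝟙 f.hom := rfl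
@[simp] theorem comp₂_hom {X Y : Sub S} {f g h : X ⟶ Y} (σ : f ⟶ g) (ρ : g ⟶ h) :
    Hom₂.hom (σ ≫ ρ) = σ.hom ≫ ρ.hom := rfl

/-- An invertible 2-cell of the ambient bicategory is one of the subbicategory. -/
def isoMk {X Y : Sub S} {f g : X ⟶ Y} (φ : f.hom ≅ g.hom) : f ≅ g where
  hom := Hom₂.mk φ.hom
  inv := Hom₂.mk φ.inv
  hom_inv_id := hom₂_ext φ.hom_inv_id
  inv_hom_id := hom₂_ext φ.inv_hom_id

@[simp] theorem isoMk_hom_hom {X Y : Sub S} {f g : X ⟶ Y} (φ : f.hom ≅ g.hom) :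
    (isoMk φ).hom.hom = φ.hom := rfl
@[simp] theorem isoMk_inv_hom {X Y : Sub S} {f g : X ⟶ Y} (φ : f.hom ≅ g.hom) :
    (isoMk φ).inv.hom = φ.inv := rfl

instance bicategory : Bicategory (Sub S) where
  whiskerLeft f _ _ σ := Hom₂.mk ((Hom.hom f) ◁ (Hom₂.hom σ))
  whiskerRight σ h := Hom₂.mk ((Hom₂.hom σ) ▷ (Hom.hom h))
  associator f g h := isoMk (α_ (Hom.hom f) (Hom.hom g) (Hom.hom h))
  leftUnitor f := isoMk (λ_ (Hom.hom f))
  rightUnitor f := isoMk (ρ_ (Hom.hom f))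
  whiskerLeft_id f g := hom₂_ext (Bicategory.whiskerLeft_id (Hom.hom f) (Hom.hom g))
  whiskerLeft_comp f _ _ _ σ ρ := hom₂_ext (Bicategory.whiskerLeft_comp (Hom.hom f) (Hom₂.hom σ) (Hom₂.hom ρ))
  id_whiskerLeft σ := hom₂_ext (Bicategory.id_whiskerLeft (Hom₂.hom σ))
  comp_whiskerLeft f g _ _ σ := hom₂_ext (Bicategory.comp_whiskerLeft (Hom.hom f) (Hom.hom g) (Hom₂.hom σ))
  id_whiskerRight f g := hom₂_ext (Bicategory.id_whiskerRight (Hom.hom f) (Hom.hom g))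
  comp_whiskerRight σ ρ g := hom₂_ext (Bicategory.comp_whiskerRight (Hom₂.hom σ) (Hom₂.hom ρ) (Hom.hom g))
  whiskerRight_id σ := hom₂_ext (Bicategory.whiskerRight_id (Hom₂.hom σ))
  whiskerRight_comp σ g h := hom₂_ext (Bicategory.whiskerRight_comp (Hom₂.hom σ) (Hom.hom g) (Hom.hom h))
  whisker_assoc f _ _ σ h := hom₂_ext (Bicategory.whisker_assoc (Hom.hom f) (Hom₂.hom σ) (Hom.hom h))
  whisker_exchange {_ _ _ _ _ _ _} σ ρ := hom₂_ext (Bicategory.whisker_exchange (Hom₂.hom σ) (Hom₂.hom ρ))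
  pentagon f g h k := hom₂_ext (Bicategory.pentagon (Hom.hom f) (Hom.hom g) (Hom.hom h) (Hom.hom k))
  triangle f g := hom₂_ext (Bicategory.triangle (Hom.hom f) (Hom.hom g))

/-- A pseudofunctor takes values in a subbicategory. -/
structure Factors (S : SubData B) {A : Type u₁} [Bicategory.{w₁, v₁} A] (F : A ⥤ᵖ B) : Prop where
  obj : ∀ a : A, S.P (F.obj a)
  map : ∀ {a b : A} (f : a ⟶ b), S.Q (F.map f)

/-- A pseudofunctor that takes values in a subbicategory, as a pseudofunctor to it. -/
def lift {A : Type u₁} [Bicategory.{w₁, v₁} A] (F : A ⥤ᵖ B) (h : Factors S F) : A ⥤ᵖ Sub S where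
  obj a := ⟨F.obj a, h.obj a⟩
  map f := Hom.mk (F.map f) (h.map f)
  map₂ σ := Hom₂.mk (F.map₂ σ)
  mapId a := isoMk (F.mapId a)
  mapComp f g := isoMk (F.mapComp f g)
  map₂_id f := hom₂_ext (F.map₂_id f)
  map₂_comp σ ρ := hom₂_ext (F.map₂_comp σ ρ)
  map₂_whisker_left f _ _ η := hom₂_ext (F.map₂_whisker_left f η)
  map₂_whisker_right η f := hom₂_ext (F.map₂_whisker_right η f)
  map₂_associator f g k := hom₂_ext (F.map₂_associator f g k)
  map₂_left_unitor f := hom₂_ext (F.map₂_left_unitor f)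
  map₂_right_unitor f := hom₂_ext (F.map₂_right_unitor f)

end Sub

end SubBicategory

/-! ## Displayed categories -/

/-- The objects of the total category of a family `Obj` of types of objects over `C`. -/
structure TotalObj {C : Type u} (Obj : C → Type w) where
  base : C
  fib : Obj base

/-- A displayed category over `C`: a type `Obj x` of objects over every `x : C`, and sets of
morphisms lying over the morphisms of `C`.  The family `f ↦ Hom_f(a, b)` of sets of morphisms over
`f : x ⟶ y` is presented by its total set `(x, a) ⟶ (y, b)` together with the map `proj` that
sends a morphism to the morphism of `C` it lies over; the morphisms over `f` are those `φ` with
`proj φ = f`.  The objects over `x` are a genuine family, so that no equality of objects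
occurs. -/
structure DispCat (C : Type u) [Category.{v} C] where
  Obj : C → Type w
  cat : Category.{v} (TotalObj Obj)
  proj : ∀ {X Y : TotalObj Obj}, (X ⟶ Y) → (X.base ⟶ Y.base)
  proj_id : ∀ X : TotalObj Obj, proj (𝟙 X) = 𝟙 X.base
  proj_comp : ∀ {X Y Z : TotalObj Obj} (φ : X ⟶ Y) (ψ : Y ⟶ Z), proj (φ ≫ ψ) = proj φ ≫ proj ψ

namespace DispCat

variable {C : Type u} [Category.{v} C]

/-- The total category. -/
abbrev Total (D : DispCat.{w, v, u} C) : Type (max u w) := TotalObj D.Obj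

instance (D : DispCat.{w, v, u} C) : Category.{v} D.Total := D.cat

attribute [simp] DispCat.proj_id DispCat.proj_comp

variable (D : DispCat.{w, v, u} C)

/-- A morphism `φ` over `f = proj φ` is Cartesian if every morphism over `g ≫ f` into its target
factors uniquely through `φ` by a morphism over `g`. -/
def IsCartesian {X Y : D.Total} (φ : X ⟶ Y) : Prop :=
  ∀ (W : D.Total) (g : W.base ⟶ X.base) (ψ : W ⟶ Y), D.proj ψ = g ≫ D.proj φ →
    ∃! κ : W ⟶ X, D.proj κ = g ∧ κ ≫ φ = ψ

/-- Every morphism of the base has a Cartesian lift to every object over its target. -/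
def IsFibration : Prop :=
  ∀ ⦃x y : C⦄ (f : x ⟶ y) (b : D.Obj y), ∃ (a : D.Obj x) (φ : (⟨x, a⟩ : D.Total) ⟶ ⟨y, b⟩),
    D.proj φ = f ∧ D.IsCartesian φ

/-- The objects of the fibre category over `x`. -/
structure Fiber (x : C) : Type w where
  obj : D.Obj x

variable {D} in
/-- The object of the total category underlying an object of a fibre. -/
abbrev Fiber.tot {x : C} (a : D.Fiber x) : D.Total := ⟨x, a.obj⟩

variable {D} in
/-- Morphisms in the fibre over `x` are the morphisms over `𝟙 x`. -/
@[ext] structure FiberHom {x : C} (a b : D.Fiber x) : Type v where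
  val : a.tot ⟶ b.tot
  proj_val : D.proj val = 𝟙 x

/-- The fibre category over `x`. -/
instance fiberCategory (x : C) : Category.{v} (D.Fiber x) where
  Hom a b := FiberHom a b
  id a := ⟨𝟙 a.tot, D.proj_id _⟩
  comp φ ψ := ⟨φ.val ≫ ψ.val, by
    rw [D.proj_comp, φ.proj_val, ψ.proj_val]; exact Category.comp_id (𝟙 x)⟩
  id_comp φ := FiberHom.ext (Category.id_comp φ.val)
  comp_id φ := FiberHom.ext (Category.comp_id φ.val)
  assoc φ ψ χ := FiberHom.ext (Category.assoc φ.val ψ.val χ.val)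

variable {D}

@[ext] theorem fiber_hom_ext {x : C} {a b : D.Fiber x} {φ ψ : a ⟶ b} (h : φ.val = ψ.val) :
    φ = ψ :=
  FiberHom.ext h

@[simp] theorem fiber_id_val {x : C} (a : D.Fiber x) : (𝟙 a : a ⟶ a).val = 𝟙 a.tot := rfl

@[simp] theorem fiber_comp_val {x : C} {a b c : D.Fiber x} (φ : a ⟶ b) (ψ : b ⟶ c) :
    (φ ≫ ψ).val = φ.val ≫ ψ.val := rfl

/-! ### Reindexing -/

theorem IsCartesian.comp {X Y Z : D.Total} {φ : X ⟶ Y} {ψ : Y ⟶ Z} (hφ : D.IsCartesian φ)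
    (hψ : D.IsCartesian ψ) : D.IsCartesian (φ ≫ ψ) := by
  intro W g θ hθ
  obtain ⟨κ, ⟨h₁, h₂⟩, h₃⟩ := hψ W (g ≫ D.proj φ) θ (by simpa using hθ)
  obtain ⟨l, ⟨k₁, k₂⟩, k₃⟩ := hφ W g κ h₁
  refine ⟨l, ⟨k₁, by rw [← Category.assoc, k₂, h₂]⟩, ?_⟩
  rintro m ⟨m₁, m₂⟩
  exact k₃ m ⟨m₁, h₃ _ ⟨by simp [m₁], by simpa using m₂⟩⟩

section

variable (h : D.IsFibration) {x y : C} (f : x ⟶ y)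

/-- The object `f^* b`. -/
noncomputable def pull (b : D.Fiber y) : D.Fiber x := ⟨(h f b.obj).choose⟩

/-- The Cartesian lift `f^* b ⟶ b` of `f`. -/
noncomputable def lift (b : D.Fiber y) : (pull h f b).tot ⟶ b.tot :=
  (h f b.obj).choose_spec.choose

theorem proj_lift (b : D.Fiber y) : D.proj (lift h f b) = f :=
  (h f b.obj).choose_spec.choose_spec.1

theorem lift_isCartesian (b : D.Fiber y) : D.IsCartesian (lift h f b) :=
  (h f b.obj).choose_spec.choose_spec.2

end

/-- The morphism over `g` that factors `ψ` through the Cartesian morphism `φ`. -/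
noncomputable def IsCartesian.factor {X Y : D.Total} {φ : X ⟶ Y} (hφ : D.IsCartesian φ)
    {W : D.Total} (g : W.base ⟶ X.base) (ψ : W ⟶ Y) (e : D.proj ψ = g ≫ D.proj φ) : W ⟶ X :=
  (hφ W g ψ e).choose

theorem IsCartesian.proj_factor {X Y : D.Total} {φ : X ⟶ Y} (hφ : D.IsCartesian φ)
    {W : D.Total} (g : W.base ⟶ X.base) (ψ : W ⟶ Y) (e : D.proj ψ = g ≫ D.proj φ) :
    D.proj (hφ.factor g ψ e) = g :=
  (hφ W g ψ e).choose_spec.1.1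


theorem IsCartesian.factor_comp {X Y : D.Total} {φ : X ⟶ Y} (hφ : D.IsCartesian φ)
    {W : D.Total} (g : W.base ⟶ X.base) (ψ : W ⟶ Y) (e : D.proj ψ = g ≫ D.proj φ) :
    hφ.factor g ψ e ≫ φ = ψ :=
  (hφ W g ψ e).choose_spec.1.2

theorem IsCartesian.hom_ext {X Y : D.Total} {φ : X ⟶ Y} (hφ : D.IsCartesian φ)
    {W : D.Total} {k l : W ⟶ X} (e : D.proj k = D.proj l) (e' : k ≫ φ = l ≫ φ) : k = l :=
  (hφ W (D.proj l) (l ≫ φ) (by simp)).unique ⟨e, e'⟩ ⟨rfl, rfl⟩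

section

variable (h : D.IsFibration) {x y : C} (f : x ⟶ y)

/-- The morphism over `𝟙 x` that factors a morphism over `f` through the Cartesian lift of `f`. -/
noncomputable def factorLift {a : D.Fiber x} {b : D.Fiber y} (ψ : a.tot ⟶ b.tot)
    (e : D.proj ψ = f) : a ⟶ pull h f b where
  val := (lift_isCartesian h f b).factor (𝟙 x) ψ
    (by rw [e, proj_lift]; exact (Category.id_comp f).symm)
  proj_val := IsCartesian.proj_factor _ _ _ _

@[simp]
theorem factorLift_lift {a : D.Fiber x} {b : D.Fiber y} (ψ : a.tot ⟶ b.tot)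
    (e : D.proj ψ = f) : (factorLift h f ψ e).val ≫ lift h f b = ψ :=
  IsCartesian.factor_comp _ _ _ _

@[simp]
theorem factorLift_lift_assoc {a : D.Fiber x} {b : D.Fiber y} (ψ : a.tot ⟶ b.tot)
    (e : D.proj ψ = f) {Z : D.Total} (k : b.tot ⟶ Z) :
    (factorLift h f ψ e).val ≫ lift h f b ≫ k = ψ ≫ k := by
  rw [← Category.assoc, factorLift_lift]

theorem pull_hom_ext {a : D.Fiber x} {b : D.Fiber y} {φ ψ : a ⟶ pull h f b}
    (e : φ.val ≫ lift h f b = ψ.val ≫ lift h f b) : φ = ψ :=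
  fiber_hom_ext ((lift_isCartesian h f b).hom_ext (φ.proj_val.trans ψ.proj_val.symm) e)

/-- The action of `f^*` on morphisms: the morphism over the identity that commutes with the
Cartesian lifts. -/
noncomputable def pullMap {b c : D.Fiber y} (φ : b ⟶ c) : pull h f b ⟶ pull h f c :=
  factorLift h f (lift h f b ≫ φ.val)
    (by rw [D.proj_comp, φ.proj_val, proj_lift]; exact Category.comp_id f)

@[simp]
theorem pullMap_lift {b c : D.Fiber y} (φ : b ⟶ c) :
    (pullMap h f φ).val ≫ lift h f c = lift h f b ≫ φ.val :=
  factorLift_lift _ _ _ _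

@[simp]
theorem pullMap_lift_assoc {b c : D.Fiber y} (φ : b ⟶ c) {Z : D.Total} (k : c.tot ⟶ Z) :
    (pullMap h f φ).val ≫ lift h f c ≫ k = lift h f b ≫ φ.val ≫ k := by
  rw [← Category.assoc, pullMap_lift, Category.assoc]

/-- The reindexing (substitution) functor `f^* : D_y ⥤ D_x`. -/
noncomputable def reindex : D.Fiber y ⥤ D.Fiber x where
  obj b := pull h f b
  map φ := pullMap h f φ
  map_id b := pull_hom_ext h f (by simp)
  map_comp φ ψ := pull_hom_ext h f (by simp)

end

section

variable (h : D.IsFibration) {a x x' y : C} {f : x ⟶ y} {g : a ⟶ x}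
  {f' : x' ⟶ y} {g' : a ⟶ x'} (e : g ≫ f = g' ≫ f')

/-- For a commutative square `g ≫ f = g' ≫ f'`, the canonical comparison `g^* f^* b ⟶ g'^* f'^* b`:
the morphism over the identity that commutes with the (composite) Cartesian lifts to `b`. -/
noncomputable def reindexSquareApp (b : D.Fiber y) :
    pull h g (pull h f b) ⟶ pull h g' (pull h f' b) :=
  factorLift h g' ((lift_isCartesian h f' b).factor g'
      (lift h g (pull h f b) ≫ lift h f b)
      (by rw [D.proj_comp, proj_lift, proj_lift, proj_lift]; exact e))
    (IsCartesian.proj_factor _ _ _ _)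

@[simp]
theorem reindexSquareApp_lift (b : D.Fiber y) :
    (reindexSquareApp h e b).val ≫ lift h g' (pull h f' b) ≫ lift h f' b =
      lift h g (pull h f b) ≫ lift h f b := by
  rw [reindexSquareApp, factorLift_lift_assoc, IsCartesian.factor_comp]

@[simp]
theorem reindexSquareApp_lift_assoc (b : D.Fiber y) {Z : D.Total} (k : b.tot ⟶ Z) :
    (reindexSquareApp h e b).val ≫ lift h g' (pull h f' b) ≫ lift h f' b ≫ k =
      lift h g (pull h f b) ≫ lift h f b ≫ k := by
  rw [← Category.assoc (lift h g' _), ← Category.assoc, reindexSquareApp_lift, Category.assoc]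

theorem reindexSquareApp_naturality {b c : D.Fiber y} (φ : b ⟶ c) :
    pullMap h g (pullMap h f φ) ≫ reindexSquareApp h e c =
      reindexSquareApp h e b ≫ pullMap h g' (pullMap h f' φ) := by
  apply pull_hom_ext h
  apply (lift_isCartesian h f' c).hom_ext
  · rw [D.proj_comp, D.proj_comp, FiberHom.proj_val, FiberHom.proj_val]
  · simp

/-- The comparison of `reindexSquareApp` as a natural transformation from `f^*` followed by `g^*`
to `f'^*` followed by `g'^*`. -/
noncomputable def reindexSquare :
    reindex h f ⋙ reindex h g ⟶ reindex h f' ⋙ reindex h g' where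
  app b := reindexSquareApp h e b
  naturality _ _ φ := reindexSquareApp_naturality h e φ

end

end DispCat

/-! ## Displayed functors and displayed natural transformations -/

/-- A displayed functor over `F`. -/
structure DispFunctor {C : Type u} [Category.{v} C] {C' : Type u₁} [Category.{v₁} C']
    (D : DispCat.{w, v, u} C) (D' : DispCat.{w₁, v₁, u₁} C') (F : C ⥤ C') where
  obj : ∀ {x : C}, D.Obj x → D'.Obj (F.obj x)
  map : ∀ {X Y : D.Total}, (X ⟶ Y) →
    ((⟨F.obj X.base, obj X.fib⟩ : D'.Total) ⟶ ⟨F.obj Y.base, obj Y.fib⟩)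
  proj_map : ∀ {X Y : D.Total} (φ : X ⟶ Y), D'.proj (map φ) = F.map (D.proj φ)
  map_id : ∀ X : D.Total, map (𝟙 X) = 𝟙 _
  map_comp : ∀ {X Y Z : D.Total} (φ : X ⟶ Y) (ψ : Y ⟶ Z), map (φ ≫ ψ) = map φ ≫ map ψ

namespace DispFunctor

variable {C : Type u} [Category.{v} C] {C' : Type u₁} [Category.{v₁} C']
  {C'' : Type u₂} [Category.{v₂} C'']
  {D : DispCat.{w, v, u} C} {D' : DispCat.{w₁, v₁, u₁} C'} {D'' : DispCat.{w₂, v₂, u₂} C''}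

attribute [simp] DispFunctor.proj_map

/-- The action on objects of the total category. -/
abbrev tot {F : C ⥤ C'} (P : DispFunctor D D' F) (X : D.Total) : D'.Total :=
  ⟨F.obj X.base, P.obj X.fib⟩

/-- The induced functor of total categories. -/
@[simps] def total {F : C ⥤ C'} (P : DispFunctor D D' F) : D.Total ⥤ D'.Total where
  obj X := P.tot X
  map φ := P.map φ
  map_id X := P.map_id X
  map_comp φ ψ := P.map_comp φ ψ

@[simp] theorem map_id' {F : C ⥤ C'} (P : DispFunctor D D' F) (X : D.Total) :
    P.map (𝟙 X) = 𝟙 (P.tot X) := P.map_id X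

@[simp]
theorem map_comp' {F : C ⥤ C'} (P : DispFunctor D D' F) {X Y Z : D.Total} (φ : X ⟶ Y)
    (ψ : Y ⟶ Z) : P.map (φ ≫ ψ) = P.map φ ≫ P.map ψ := P.map_comp φ ψ

/-- The identity displayed functor. -/
@[simps] def id (D : DispCat.{w, v, u} C) : DispFunctor D D (𝟭 C) where
  obj a := a
  map φ := φ
  proj_map _ := rfl
  map_id _ := rfl
  map_comp _ _ := rfl

/-- Composition of displayed functors, in diagrammatic order. -/
@[simps] def comp {F : C ⥤ C'} {G : C' ⥤ C''} (P : DispFunctor D D' F)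
    (Q : DispFunctor D' D'' G) : DispFunctor D D'' (F ⋙ G) where
  obj a := Q.obj (P.obj a)
  map φ := Q.map (P.map φ)
  proj_map φ := by simp
  map_id X := by simp
  map_comp φ ψ := by simp

/-- A displayed functor is Cartesian if it preserves Cartesian morphisms. -/
def IsCartesian {F : C ⥤ C'} (P : DispFunctor D D' F) : Prop :=
  ∀ ⦃X Y : D.Total⦄ (φ : X ⟶ Y), D.IsCartesian φ → D'.IsCartesian (P.map φ)

/-- The induced functor of fibre categories `D_x ⥤ D'_{F x}`. -/
def fiberFunctor {F : C ⥤ C'} (P : DispFunctor D D' F) (x : C) : D.Fiber x ⥤ D'.Fiber (F.obj x) where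
  obj a := ⟨P.obj a.obj⟩
  map φ := ⟨P.map φ.val, by rw [P.proj_map, φ.proj_val]; exact F.map_id x⟩
  map_id a := DispCat.fiber_hom_ext (P.map_id a.tot)
  map_comp φ ψ := DispCat.fiber_hom_ext (P.map_comp φ.val ψ.val)

end DispFunctor

/-- A displayed natural transformation over `τ`. -/
@[ext] structure DispNatTrans {C : Type u} [Category.{v} C] {C' : Type u₁} [Category.{v₁} C']
    {D : DispCat.{w, v, u} C} {D' : DispCat.{w₁, v₁, u₁} C'} {F G : C ⥤ C'}
    (P : DispFunctor D D' F) (Q : DispFunctor D D' G) (τ : F ⟶ G) where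
  app : ∀ X : D.Total, P.tot X ⟶ Q.tot X
  proj_app : ∀ X : D.Total, D'.proj (app X) = τ.app X.base
  naturality : ∀ {X Y : D.Total} (φ : X ⟶ Y), P.map φ ≫ app Y = app X ≫ Q.map φ

attribute [simp] DispNatTrans.proj_app
attribute [simp] DispNatTrans.naturality

@[simp] theorem DispNatTrans.naturality_assoc {C : Type u} [Category.{v} C] {C' : Type u₁}
    [Category.{v₁} C'] {D : DispCat.{w, v, u} C} {D' : DispCat.{w₁, v₁, u₁} C'} {F G : C ⥤ C'}
    {P : DispFunctor D D' F} {Q : DispFunctor D D' G} {τ : F ⟶ G} (α : DispNatTrans P Q τ)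
    {X Y : D.Total} (φ : X ⟶ Y) {Z : D'.Total} (k : Q.tot Y ⟶ Z) :
    P.map φ ≫ α.app Y ≫ k = α.app X ≫ Q.map φ ≫ k := by
  rw [← Category.assoc, α.naturality, Category.assoc]

/-! ## The arrow category, displayed over its codomains -/

/-- An object of the arrow category over `y`: a morphism into `y`. -/
structure ArrObj {C : Type u} [Category.{v} C] (y : C) where
  dom : C
  hom : dom ⟶ y

/-- A morphism of the arrow category: a commutative square; it lies over its component `base`. -/
@[ext] structure ArrHom {C : Type u} [Category.{v} C] (X Y : TotalObj (ArrObj (C := C))) where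
  base : X.base ⟶ Y.base
  top : X.fib.dom ⟶ Y.fib.dom
  comm : top ≫ Y.fib.hom = X.fib.hom ≫ base

attribute [simp] ArrHom.comm

@[simp] theorem ArrHom.comm_assoc {C : Type u} [Category.{v} C]
    {X Y : TotalObj (ArrObj (C := C))} (φ : ArrHom X Y) {Z : C} (k : Y.base ⟶ Z) :
    φ.top ≫ Y.fib.hom ≫ k = X.fib.hom ≫ φ.base ≫ k := by
  rw [← Category.assoc, φ.comm, Category.assoc]

section

variable (C : Type u) [Category.{v} C]

/-- The displayed arrow category of `C`. -/
def arr : DispCat.{max u v, v, u} C where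
  Obj := ArrObj
  cat :=
    { Hom := ArrHom
      id := fun X => ⟨𝟙 _, 𝟙 _, by simp⟩
      comp := fun φ ψ => ⟨φ.base ≫ ψ.base, φ.top ≫ ψ.top, by simp⟩ }
  proj φ := φ.base
  proj_id _ := rfl
  proj_comp _ _ := rfl

end

section

variable {C : Type u} [Category.{v} C]

/-- The domain of an object of the arrow category. -/
abbrev arrDom (X : (arr C).Total) : C := ArrObj.dom X.fib

/-- The morphism of `C` that is an object of the arrow category. -/
abbrev arrMor (X : (arr C).Total) : arrDom X ⟶ X.base := ArrObj.hom X.fib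

/-- The component between codomains of a morphism of the arrow category. -/
def arrBase {X Y : (arr C).Total} (φ : X ⟶ Y) : X.base ⟶ Y.base := ArrHom.base φ

/-- The component between domains of a morphism of the arrow category. -/
def arrTop {X Y : (arr C).Total} (φ : X ⟶ Y) : arrDom X ⟶ arrDom Y := ArrHom.top φ

@[simp]
theorem arr_comm {X Y : (arr C).Total} (φ : X ⟶ Y) :
    arrTop φ ≫ arrMor Y = arrMor X ≫ arrBase φ := ArrHom.comm φ

/-- Constructor for morphisms of the arrow category. -/
def arrMk {X Y : (arr C).Total} (b : X.base ⟶ Y.base) (t : arrDom X ⟶ arrDom Y)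
    (h : t ≫ arrMor Y = arrMor X ≫ b) : X ⟶ Y := ArrHom.mk b t h

@[ext] theorem arr_hom_ext {X Y : (arr C).Total} {φ ψ : X ⟶ Y} (h : arrBase φ = arrBase ψ)
    (h' : arrTop φ = arrTop ψ) : φ = ψ := ArrHom.ext h h'

@[simp] theorem arrBase_mk {X Y : (arr C).Total} (b : X.base ⟶ Y.base) (t : arrDom X ⟶ arrDom Y)
    (h : t ≫ arrMor Y = arrMor X ≫ b) : arrBase (arrMk b t h) = b := rfl

@[simp] theorem arrTop_mk {X Y : (arr C).Total} (b : X.base ⟶ Y.base) (t : arrDom X ⟶ arrDom Y)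
    (h : t ≫ arrMor Y = arrMor X ≫ b) : arrTop (arrMk b t h) = t := rfl

@[simp] theorem arrBase_id (X : (arr C).Total) : arrBase (𝟙 X) = 𝟙 _ := rfl

@[simp] theorem arrTop_id (X : (arr C).Total) : arrTop (𝟙 X) = 𝟙 _ := rfl

@[simp] theorem arrBase_comp {X Y Z : (arr C).Total} (φ : X ⟶ Y) (ψ : Y ⟶ Z) :
    arrBase (φ ≫ ψ) = arrBase φ ≫ arrBase ψ := rfl

@[simp] theorem arrTop_comp {X Y Z : (arr C).Total} (φ : X ⟶ Y) (ψ : Y ⟶ Z) :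
    arrTop (φ ≫ ψ) = arrTop φ ≫ arrTop ψ := rfl

theorem arr_proj {X Y : (arr C).Total} (φ : X ⟶ Y) : (arr C).proj φ = arrBase φ := rfl

variable {C' : Type u₁} [Category.{v₁} C']

/-- The displayed functor between arrow categories induced by a functor. -/
def arrFunctor (F : C ⥤ C') : DispFunctor (arr C) (arr C') F where
  obj a := ArrObj.mk (F.obj (ArrObj.dom a)) (F.map (ArrObj.hom a))
  map φ := arrMk (F.map (arrBase φ)) (F.map (arrTop φ))
    ((F.map_comp _ _).symm.trans ((congrArg F.map (arr_comm φ)).trans (F.map_comp _ _)))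
  proj_map _ := rfl
  map_id _ := arr_hom_ext (F.map_id _) (F.map_id _)
  map_comp _ _ := arr_hom_ext (F.map_comp _ _) (F.map_comp _ _)

/-- The displayed natural transformation induced by a natural transformation. -/
def arrNatTrans {F G : C ⥤ C'} (τ : F ⟶ G) : DispNatTrans (arrFunctor F) (arrFunctor G) τ where
  app X := arrMk (τ.app X.base) (τ.app (arrDom X)) (τ.naturality (arrMor X)).symm
  proj_app _ := rfl
  naturality _ := arr_hom_ext (τ.naturality _) (τ.naturality _)

@[simp] theorem arrNatTrans_id (F : C ⥤ C') (X : (arr C).Total) :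
    (arrNatTrans (𝟙 F)).app X = 𝟙 ((arrFunctor F).tot X) := rfl

@[simp] theorem arrNatTrans_comp {F G H : C ⥤ C'} (σ : F ⟶ G) (τ : G ⟶ H) (X : (arr C).Total) :
    (arrNatTrans (σ ≫ τ)).app X = (arrNatTrans σ).app X ≫ (arrNatTrans τ).app X := rfl

/-- The Cartesian morphisms of the arrow category are the pullback squares. -/
theorem arr_isCartesian_iff {X Y : (arr C).Total} (φ : X ⟶ Y) :
    (arr C).IsCartesian φ ↔ IsPullback (arrTop φ) (arrMor X) (arrMor Y) (arrBase φ) := by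
  constructor
  · intro h
    have key (s : PullbackCone (arrMor Y) (arrBase φ)) :
        ∃! t : s.pt ⟶ arrDom X, t ≫ arrTop φ = s.fst ∧ t ≫ arrMor X = s.snd := by
      let W : (arr C).Total := ⟨X.base, ArrObj.mk s.pt s.snd⟩
      obtain ⟨κ, ⟨h₁, h₂⟩, h₃⟩ := h W (𝟙 X.base)
        (arrMk (X := W) (Y := Y) (arrBase (X := X) φ) s.fst s.condition) (Category.id_comp _).symm
      refine ⟨arrTop κ, ⟨congrArg arrTop h₂, ?_⟩, ?_⟩
      · refine (arr_comm κ).trans ?_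
        rw [arr_proj] at h₁
        rw [h₁]
        exact Category.comp_id _
      · rintro t ⟨t₁, t₂⟩
        have := h₃ (arrMk (X := W) (𝟙 X.base) t (t₂.trans (Category.comp_id _).symm))
          ⟨rfl, arr_hom_ext (Category.id_comp _) t₁⟩
        exact congrArg arrTop this
    refine ⟨⟨arr_comm φ⟩, ⟨PullbackCone.IsLimit.mk _ (fun s => (key s).choose)
      (fun s => (key s).choose_spec.1.1) (fun s => (key s).choose_spec.1.2)
      (fun s m m₁ m₂ => (key s).choose_spec.2 m ⟨m₁, m₂⟩)⟩⟩
  · intro h W g ψ e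
    have e' : arrBase ψ = g ≫ arrBase φ := e
    refine ⟨arrMk g (h.lift (arrTop ψ) (arrMor W ≫ g) (by simp [e'])) (by simp), ⟨rfl, ?_⟩, ?_⟩
    · ext <;> simp [e']
    · rintro κ ⟨h₁, h₂⟩
      have h₁' : arrBase κ = g := h₁
      subst h₂
      ext
      · simp [h₁']
      · apply h.hom_ext <;> simp [h₁']

end

/-! ## Comprehension categories -/

/-- A comprehension category: a category `C` with a terminal object, a displayed category `D` over
`C` which is a fibration, and a Cartesian displayed functor `χ` over the identity from `D` to the
arrow category of `C`. -/
structure CompCat where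
  C : Type u
  [cat : Category.{v} C]
  [hasTerminal : HasTerminal C]
  D : DispCat.{max u v, v, u} C
  fib : D.IsFibration
  χ : DispFunctor D (arr C) (𝟭 C)
  χ_cartesian : χ.IsCartesian

namespace CompCat

set_option linter.unusedSimpArgs false

instance (X : CompCat.{v, u}) : Category.{v} X.C := X.cat

instance (X : CompCat.{v, u}) : HasTerminal X.C := X.hasTerminal

/-- A lax morphism of comprehension categories: a functor `F` preserving terminal objects, a
Cartesian displayed functor `P` over `F`, and a displayed natural transformation `θ` over the
identity from `χ` followed by the functor induced by `F` on arrow categories to `P` followed by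
`χ`. -/
structure Hom (X Y : CompCat.{v, u}) where
  F : X.C ⥤ Y.C
  preservesTerminal : PreservesLimitsOfShape (Discrete PEmpty.{1}) F
  P : DispFunctor X.D Y.D F
  P_cartesian : P.IsCartesian
  θ : DispNatTrans (X.χ.comp (arrFunctor F)) (P.comp Y.χ) (F.leftUnitor.hom ≫ F.rightUnitor.inv)

/-- The component of `θ` at `A`. -/
def Hom.θApp {X Y : CompCat.{v, u}} (f : Hom X Y) (A : X.D.Total) :
    (arrFunctor f.F).tot (X.χ.tot A) ⟶ Y.χ.tot (f.P.tot A) := f.θ.app A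

@[simp]
theorem Hom.θApp_naturality {X Y : CompCat.{v, u}} (f : Hom X Y) {A B : X.D.Total} (φ : A ⟶ B) :
    (arrFunctor f.F).map (X.χ.map φ) ≫ f.θApp B = f.θApp A ≫ Y.χ.map (f.P.map φ) :=
  f.θ.naturality φ

theorem Hom.arrBase_θApp {X Y : CompCat.{v, u}} (f : Hom X Y) (A : X.D.Total) :
    arrBase (f.θApp A) = 𝟙 (f.F.obj A.base) :=
  (f.θ.proj_app A).trans (Category.comp_id (𝟙 (f.F.obj A.base)))

/-- A 2-cell: a natural transformation `τ`, and a displayed natural transformation `α` over `τ`,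
compatible with the comprehension. -/
structure Hom₂ {X Y : CompCat.{v, u}} (f g : Hom X Y) where
  τ : f.F ⟶ g.F
  α : DispNatTrans f.P g.P τ
  comm : ∀ A : X.D.Total,
    f.θApp A ≫ Y.χ.map (α.app A) = (arrNatTrans τ).app (X.χ.tot A) ≫ g.θApp A

theorem Hom₂.ext {X Y : CompCat.{v, u}} {f g : Hom X Y} {σ σ' : Hom₂ f g}
    (h : ∀ x, σ.τ.app x = σ'.τ.app x) (h' : ∀ A, σ.α.app A = σ'.α.app A) : σ = σ' := by
  obtain ⟨τ, α, _⟩ := σ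
  obtain ⟨τ', α', _⟩ := σ'
  obtain rfl : τ = τ' := by ext x; exact h x
  obtain rfl : α = α' := by ext A; exact h' A
  rfl

attribute [simp] Hom₂.comm

@[simp] theorem Hom₂.comm_assoc {X Y : CompCat.{v, u}} {f g : Hom X Y} (σ : Hom₂ f g)
    (A : X.D.Total) {Z : (arr Y.C).Total} (k : Y.χ.tot (g.P.tot A) ⟶ Z) :
    f.θApp A ≫ Y.χ.map (σ.α.app A) ≫ k =
      (arrNatTrans σ.τ).app (X.χ.tot A) ≫ g.θApp A ≫ k := by
  rw [← Category.assoc, σ.comm, Category.assoc]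

instance : Quiver CompCat.{v, u} where
  Hom X Y := Hom X Y

instance (X Y : CompCat.{v, u}) : Quiver (X ⟶ Y) where
  Hom f g := Hom₂ f g

theorem hom₂_ext {X Y : CompCat.{v, u}} {f g : X ⟶ Y} {σ σ' : f ⟶ g}
    (h : ∀ x, σ.τ.app x = σ'.τ.app x) (h' : ∀ A, σ.α.app A = σ'.α.app A) : σ = σ' :=
  Hom₂.ext h h'

instance homCategory (X Y : CompCat.{v, u}) : Category (X ⟶ Y) where
  id f :=
    { τ := 𝟙 f.F
      α := { app := fun A => 𝟙 _, proj_app := by simp, naturality := by simp }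
      comm := by simp }
  comp {f g k} σ ρ :=
    { τ := σ.τ ≫ ρ.τ
      α := { app := fun A => σ.α.app A ≫ ρ.α.app A, proj_app := by simp, naturality := by simp }
      comm := by simp }
  id_comp σ := by apply hom₂_ext <;> intros <;> simp
  comp_id σ := by apply hom₂_ext <;> intros <;> simp
  assoc σ ρ κ := by apply hom₂_ext <;> intros <;> simp

@[simp] theorem id_τ {X Y : CompCat.{v, u}} (f : X ⟶ Y) : Hom₂.τ (𝟙 f) = 𝟙 f.F := rfl

@[simp] theorem id_α_app {X Y : CompCat.{v, u}} (f : X ⟶ Y) (A : X.D.Total) :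
    (Hom₂.α (𝟙 f)).app A = 𝟙 (f.P.tot A) := rfl

@[simp] theorem comp_τ {X Y : CompCat.{v, u}} {f g h : X ⟶ Y} (σ : f ⟶ g) (ρ : g ⟶ h) :
    Hom₂.τ (σ ≫ ρ) = σ.τ ≫ ρ.τ := rfl

@[simp] theorem comp_α_app {X Y : CompCat.{v, u}} {f g h : X ⟶ Y} (σ : f ⟶ g) (ρ : g ⟶ h)
    (A : X.D.Total) : (Hom₂.α (σ ≫ ρ)).app A = σ.α.app A ≫ ρ.α.app A := rfl

/-- A 2-cell is invertible if its components are. -/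
noncomputable def isoMk {X Y : CompCat.{v, u}} {f g : X ⟶ Y} (σ : f ⟶ g)
    (h : ∀ x, IsIso (σ.τ.app x)) (h' : ∀ A, IsIso (σ.α.app A)) : f ≅ g where
  hom := σ
  inv :=
    { τ := { app := fun x => inv (σ.τ.app x) }
      α :=
        { app := fun A => inv (σ.α.app A)
          proj_app := fun A => by
            rw [← cancel_epi (σ.τ.app A.base), IsIso.hom_inv_id, ← σ.α.proj_app A,
              ← Y.D.proj_comp, IsIso.hom_inv_id, Y.D.proj_id]
          naturality := fun φ => by
            rw [IsIso.eq_inv_comp, ← Category.assoc, ← σ.α.naturality, Category.assoc,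
              IsIso.hom_inv_id, Category.comp_id] }
      comm := fun A => by
        have e := σ.comm A
        have e₁ : (arrNatTrans ({ app := fun x => inv (σ.τ.app x) } : g.F ⟶ f.F)).app (X.χ.tot A) ≫
            (arrNatTrans σ.τ).app (X.χ.tot A) = 𝟙 _ := by
          rw [← arrNatTrans_comp, ← arrNatTrans_id]
          exact congrArg (fun t => (arrNatTrans t).app (X.χ.tot A))
            (by ext x; exact IsIso.inv_hom_id (σ.τ.app x))
        have e₂ : Y.χ.map (σ.α.app A) ≫ Y.χ.map (inv (σ.α.app A)) = 𝟙 _ := by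
          rw [← DispFunctor.map_comp, IsIso.hom_inv_id, DispFunctor.map_id]
        have e₃ := congrArg (fun t => (arrNatTrans ({ app := fun x => inv (σ.τ.app x) } :
          g.F ⟶ f.F)).app (X.χ.tot A) ≫ t ≫ Y.χ.map (inv (σ.α.app A))) e
        simp only [Category.assoc, e₂, Category.comp_id] at e₃
        rw [e₃, ← Category.assoc, e₁, Category.id_comp] }
  hom_inv_id := by apply hom₂_ext <;> intros <;> simp
  inv_hom_id := by apply hom₂_ext <;> intros <;> simp

/-- The identity morphism. -/
def Hom.id (X : CompCat.{v, u}) : Hom X X where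
  F := 𝟭 X.C
  preservesTerminal := inferInstance
  P := DispFunctor.id X.D
  P_cartesian := fun _ _ _ h => h
  θ :=
    { app := fun A => 𝟙 (X.χ.tot A)
      proj_app := fun A => (Category.comp_id (𝟙 A.base)).symm
      naturality := fun φ => (Category.comp_id (X.χ.map φ)).trans (Category.id_comp _).symm }

/-- Composition of lax morphisms, in diagrammatic order. -/
def Hom.comp {X Y Z : CompCat.{v, u}} (f : Hom X Y) (g : Hom Y Z) : Hom X Z where
  F := f.F ⋙ g.F
  preservesTerminal :=
    have := f.preservesTerminal
    have := g.preservesTerminal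
    inferInstance
  P := f.P.comp g.P
  P_cartesian := fun _ _ _ h => g.P_cartesian _ (f.P_cartesian _ h)
  θ :=
    { app := fun A => (arrFunctor g.F).map (f.θApp A) ≫ g.θApp (f.P.tot A)
      proj_app := fun A => by
        have h : arrBase ((arrFunctor g.F).map (f.θApp A)) =
            𝟙 (g.F.obj (f.F.obj A.base)) :=
          (congrArg g.F.map (f.arrBase_θApp A)).trans (g.F.map_id _)
        refine ((arr Z.C).proj_comp _ _).trans ?_
        exact congrArg₂ (· ≫ ·) h (g.arrBase_θApp (f.P.tot A))
      naturality := fun φ => by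
        have h := congrArg (arrFunctor g.F).map (f.θApp_naturality φ)
        rw [DispFunctor.map_comp, DispFunctor.map_comp] at h
        have h' := g.θApp_naturality (f.P.map φ)
        change (arrFunctor g.F).map ((arrFunctor f.F).map (X.χ.map φ)) ≫
          ((arrFunctor g.F).map (f.θApp _) ≫ g.θApp (f.P.tot _)) =
          ((arrFunctor g.F).map (f.θApp _) ≫ g.θApp (f.P.tot _)) ≫ Z.χ.map (g.P.map (f.P.map φ))
        rw [Category.assoc, ← h', ← Category.assoc, h, Category.assoc] }

instance : CategoryStruct CompCat.{v, u} where
  id X := Hom.id X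
  comp f g := Hom.comp f g

@[simp] theorem id_F (X : CompCat.{v, u}) : Hom.F (𝟙 X) = 𝟭 X.C := rfl
@[simp] theorem id_P (X : CompCat.{v, u}) : Hom.P (𝟙 X) = DispFunctor.id X.D := rfl
@[simp] theorem id_θApp (X : CompCat.{v, u}) (A : X.D.Total) :
    Hom.θApp (𝟙 X) A = 𝟙 (X.χ.tot A) := rfl
@[simp] theorem comp_F {X Y Z : CompCat.{v, u}} (f : X ⟶ Y) (g : Y ⟶ Z) :
    Hom.F (f ≫ g) = f.F ⋙ g.F := rfl
@[simp] theorem comp_P {X Y Z : CompCat.{v, u}} (f : X ⟶ Y) (g : Y ⟶ Z) :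
    Hom.P (f ≫ g) = f.P.comp g.P := rfl
@[simp] theorem comp_θApp {X Y Z : CompCat.{v, u}} (f : X ⟶ Y) (g : Y ⟶ Z) (A : X.D.Total) :
    Hom.θApp (f ≫ g) A = (arrFunctor g.F).map (f.θApp A) ≫ g.θApp (f.P.tot A) := rfl

/-- Left whiskering. -/
def whiskerL {X Y Z : CompCat.{v, u}} (f : X ⟶ Y) {g h : Y ⟶ Z} (σ : g ⟶ h) : f ≫ g ⟶ f ≫ h where
  τ := Functor.whiskerLeft f.F σ.τ
  α :=
    { app := fun A => σ.α.app (f.P.tot A)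
      proj_app := fun A => σ.α.proj_app _
      naturality := fun φ => σ.α.naturality _ }
  comm := fun A => by
    have h₁ := σ.comm (f.P.tot A)
    have h₂ := (arrNatTrans σ.τ).naturality (f.θApp A)
    change ((arrFunctor g.F).map (f.θApp A) ≫ g.θApp (f.P.tot A)) ≫ Z.χ.map (σ.α.app (f.P.tot A)) =
      (arrNatTrans σ.τ).app ((arrFunctor f.F).tot (X.χ.tot A)) ≫
        ((arrFunctor h.F).map (f.θApp A) ≫ h.θApp (f.P.tot A))
    rw [Category.assoc, h₁, ← Category.assoc, h₂, Category.assoc]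

/-- Right whiskering. -/
def whiskerR {X Y Z : CompCat.{v, u}} {f g : X ⟶ Y} (σ : f ⟶ g) (h : Y ⟶ Z) : f ≫ h ⟶ g ≫ h where
  τ := Functor.whiskerRight σ.τ h.F
  α :=
    { app := fun A => h.P.map (σ.α.app A)
      proj_app := fun A => (h.P.proj_map _).trans (congrArg h.F.map (σ.α.proj_app A))
      naturality := fun φ => by
        have e := congrArg h.P.map (σ.α.naturality φ)
        rw [DispFunctor.map_comp, DispFunctor.map_comp] at e
        exact e }
  comm := fun A => by
    have h₁ := congrArg (arrFunctor h.F).map (σ.comm A)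
    rw [DispFunctor.map_comp, DispFunctor.map_comp] at h₁
    have h₂ := h.θApp_naturality (σ.α.app A)
    change ((arrFunctor h.F).map (f.θApp A) ≫ h.θApp (f.P.tot A)) ≫
        Z.χ.map (h.P.map (σ.α.app A)) =
      (arrFunctor h.F).map ((arrNatTrans σ.τ).app (X.χ.tot A)) ≫
        ((arrFunctor h.F).map (g.θApp A) ≫ h.θApp (g.P.tot A))
    rw [Category.assoc, ← h₂, ← Category.assoc, h₁, Category.assoc]

/-- The associator: all its components are identities. -/
def assoc {W X Y Z : CompCat.{v, u}} (f : W ⟶ X) (g : X ⟶ Y) (h : Y ⟶ Z) :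
    (f ≫ g) ≫ h ≅ f ≫ g ≫ h where
  hom :=
    { τ := (Functor.associator f.F g.F h.F).hom
      α := { app := fun A => 𝟙 (h.P.tot (g.P.tot (f.P.tot A)))
             proj_app := fun A => Z.D.proj_id _
             naturality := fun φ => (Category.comp_id _).trans (Category.id_comp _).symm }
      comm := fun A => by
        change ((arrFunctor h.F).map ((arrFunctor g.F).map (f.θApp A) ≫ g.θApp (f.P.tot A)) ≫
            h.θApp (g.P.tot (f.P.tot A))) ≫ Z.χ.map (𝟙 (h.P.tot (g.P.tot (f.P.tot A)))) =
          𝟙 _ ≫ ((arrFunctor h.F).map ((arrFunctor g.F).map (f.θApp A)) ≫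
            ((arrFunctor h.F).map (g.θApp (f.P.tot A)) ≫ h.θApp (g.P.tot (f.P.tot A))))
        rw [DispFunctor.map_id, Category.comp_id, DispFunctor.map_comp, Category.assoc]
        exact (Category.id_comp _).symm }
  inv :=
    { τ := (Functor.associator f.F g.F h.F).inv
      α := { app := fun A => 𝟙 (h.P.tot (g.P.tot (f.P.tot A)))
             proj_app := fun A => Z.D.proj_id _
             naturality := fun φ => (Category.comp_id _).trans (Category.id_comp _).symm }
      comm := fun A => by
        change ((arrFunctor h.F).map ((arrFunctor g.F).map (f.θApp A)) ≫
            ((arrFunctor h.F).map (g.θApp (f.P.tot A)) ≫ h.θApp (g.P.tot (f.P.tot A)))) ≫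
              Z.χ.map (𝟙 (h.P.tot (g.P.tot (f.P.tot A)))) =
          𝟙 _ ≫ ((arrFunctor h.F).map ((arrFunctor g.F).map (f.θApp A) ≫ g.θApp (f.P.tot A)) ≫
            h.θApp (g.P.tot (f.P.tot A)))
        rw [DispFunctor.map_id, Category.comp_id, DispFunctor.map_comp, Category.assoc]
        exact (Category.id_comp _).symm }
  hom_inv_id := by
    apply hom₂_ext
    · simp
    · intro A
      exact Category.comp_id _
  inv_hom_id := by
    apply hom₂_ext
    · simp
    · intro A
      exact Category.comp_id _

/-- The left unitor: all its components are identities. -/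
def leftUnit {X Y : CompCat.{v, u}} (f : X ⟶ Y) : 𝟙 X ≫ f ≅ f where
  hom :=
    { τ := (Functor.leftUnitor f.F).hom
      α := { app := fun A => 𝟙 (f.P.tot A)
             proj_app := fun A => Y.D.proj_id _
             naturality := fun φ => (Category.comp_id _).trans (Category.id_comp _).symm }
      comm := fun A => by
        change ((arrFunctor f.F).map (𝟙 (X.χ.tot A)) ≫ f.θApp A) ≫ Y.χ.map (𝟙 (f.P.tot A)) =
          𝟙 _ ≫ f.θApp A
        rw [DispFunctor.map_id, DispFunctor.map_id]
        exact Category.comp_id _ }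
  inv :=
    { τ := (Functor.leftUnitor f.F).inv
      α := { app := fun A => 𝟙 (f.P.tot A)
             proj_app := fun A => Y.D.proj_id _
             naturality := fun φ => (Category.comp_id _).trans (Category.id_comp _).symm }
      comm := fun A => by
        change f.θApp A ≫ Y.χ.map (𝟙 (f.P.tot A)) =
          𝟙 _ ≫ ((arrFunctor f.F).map (𝟙 (X.χ.tot A)) ≫ f.θApp A)
        rw [DispFunctor.map_id, Category.comp_id, DispFunctor.map_id]
        exact ((Category.id_comp _).trans (Category.id_comp _)).symm }
  hom_inv_id := by
    apply hom₂_ext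
    · simp
    · intro A
      exact Category.comp_id _
  inv_hom_id := by
    apply hom₂_ext
    · simp
    · intro A
      exact Category.comp_id _

/-- The right unitor: all its components are identities. -/
def rightUnit {X Y : CompCat.{v, u}} (f : X ⟶ Y) : f ≫ 𝟙 Y ≅ f where
  hom :=
    { τ := (Functor.rightUnitor f.F).hom
      α := { app := fun A => 𝟙 (f.P.tot A)
             proj_app := fun A => Y.D.proj_id _
             naturality := fun φ => (Category.comp_id _).trans (Category.id_comp _).symm }
      comm := fun A => by
        change ((arrFunctor (𝟭 Y.C)).map (f.θApp A) ≫ 𝟙 (Y.χ.tot (f.P.tot A))) ≫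
          Y.χ.map (𝟙 (f.P.tot A)) = 𝟙 _ ≫ f.θApp A
        rw [DispFunctor.map_id]
        exact ((Category.comp_id _).trans (Category.comp_id _)).trans (Category.id_comp _).symm }
  inv :=
    { τ := (Functor.rightUnitor f.F).inv
      α := { app := fun A => 𝟙 (f.P.tot A)
             proj_app := fun A => Y.D.proj_id _
             naturality := fun φ => (Category.comp_id _).trans (Category.id_comp _).symm }
      comm := fun A => by
        change f.θApp A ≫ Y.χ.map (𝟙 (f.P.tot A)) =
          𝟙 _ ≫ ((arrFunctor (𝟭 Y.C)).map (f.θApp A) ≫ 𝟙 (Y.χ.tot (f.P.tot A)))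
        rw [DispFunctor.map_id]
        exact (Category.comp_id _).trans ((Category.id_comp _).trans (Category.comp_id _)).symm }
  hom_inv_id := by
    apply hom₂_ext
    · simp
    · intro A
      exact Category.comp_id _
  inv_hom_id := by
    apply hom₂_ext
    · simp
    · intro A
      exact Category.comp_id _

/-- The bicategory of comprehension categories, lax morphisms, and 2-cells. -/
instance bicategory : Bicategory CompCat.{v, u} where
  whiskerLeft f _ _ σ := whiskerL f σ
  whiskerRight σ h := whiskerR σ h
  associator f g h := assoc f g h
  leftUnitor f := leftUnit f
  rightUnitor f := rightUnit f
  whiskerLeft_id := by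
    intros
    apply hom₂_ext
    · intro x
      simp [whiskerL, whiskerR, assoc, leftUnit, rightUnit]
    · intro A
      exact rfl
  whiskerLeft_comp := by
    intros
    apply hom₂_ext
    · intro x
      simp [whiskerL, whiskerR, assoc, leftUnit, rightUnit]
    · intro A
      exact rfl
  id_whiskerLeft := by
    intros
    apply hom₂_ext
    · intro x
      simp [whiskerL, whiskerR, assoc, leftUnit, rightUnit]
    · intro A
      exact ((Category.id_comp _).trans (Category.comp_id _)).symm
  comp_whiskerLeft := by
    intros
    apply hom₂_ext
    · intro x
      simp [whiskerL, whiskerR, assoc, leftUnit, rightUnit]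
    · intro A
      exact ((Category.id_comp _).trans (Category.comp_id _)).symm
  id_whiskerRight := by
    intros
    apply hom₂_ext
    · intro x
      simp [whiskerL, whiskerR, assoc, leftUnit, rightUnit]
    · intro A
      exact DispFunctor.map_id _ _
  comp_whiskerRight := by
    intros
    apply hom₂_ext
    · intro x
      simp [whiskerL, whiskerR, assoc, leftUnit, rightUnit]
    · intro A
      exact DispFunctor.map_comp _ _ _
  whiskerRight_id := by
    intros
    apply hom₂_ext
    · intro x
      simp [whiskerL, whiskerR, assoc, leftUnit, rightUnit]
    · intro A
      exact ((Category.id_comp _).trans (Category.comp_id _)).symm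
  whiskerRight_comp := by
    intros
    apply hom₂_ext
    · intro x
      simp [whiskerL, whiskerR, assoc, leftUnit, rightUnit]
    · intro A
      exact ((Category.id_comp _).trans (Category.comp_id _)).symm
  whisker_assoc := by
    intros
    apply hom₂_ext
    · intro x
      simp [whiskerL, whiskerR, assoc, leftUnit, rightUnit]
    · intro A
      exact ((Category.id_comp _).trans (Category.comp_id _)).symm
  whisker_exchange {_ _ _ _ _ _ _} σ ρ := by
    apply hom₂_ext
    · intro x
      simp [whiskerL, whiskerR]
    · intro A
      exact (DispNatTrans.naturality ρ.α (σ.α.app A)).symm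
  pentagon := by
    intros
    apply hom₂_ext
    · intro x
      simp [whiskerL, whiskerR, assoc, leftUnit, rightUnit]
    · intro A
      exact ((congrArg (· ≫ _) (DispFunctor.map_id _ _)).trans (Category.id_comp _))
  triangle := by
    intros
    apply hom₂_ext
    · intro x
      simp [whiskerL, whiskerR, assoc, leftUnit, rightUnit]
    · intro A
      exact (Category.id_comp _).trans (DispFunctor.map_id _ _).symm

end CompCat


/-! ## Univalence -/

/-- The two readings, for categories with a set of morphisms between any two objects, of "the map
`idtoiso` from identities to isomorphisms between two objects is an equivalence".

* `homotopical`: identity of two objects is isomorphism.  The objects of a category are then those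
  of a groupoid rather than the elements of a set, as in the model of univalent foundations in which
  the univalent categories are the categories of ordinary mathematics, considered up to
  equivalence.  Every category is univalent in this reading.
* `literal`: identity of two objects is equality, and `eqToIso` has to be bijective. -/
inductive UnivalenceReading
  | homotopical
  | literal

/-- A category is univalent, in the given reading. -/
def UnivalenceReading.Holds (r : UnivalenceReading) (C : Type u) [Category.{v} C] : Prop :=
  match r with
  | homotopical => True
  | literal => ∀ x y : C, Function.Bijective (fun e : x = y => eqToIso e)

/-! ## Type formers -/

namespace CompCat

section

variable (X : CompCat.{v, u})

/-- The context extension `Γ.A`: the domain of `χ A`. -/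
def ext {Γ : X.C} (A : X.D.Obj Γ) : X.C := arrDom (X.χ.tot ⟨Γ, A⟩)

/-- The projection `π_A : Γ.A ⟶ Γ`: the morphism `χ A`. -/
def π {Γ : X.C} (A : X.D.Obj Γ) : X.ext A ⟶ Γ := arrMor (X.χ.tot ⟨Γ, A⟩)

/-- The action of `χ` on a morphism from `A` to `B`, as a morphism of context extensions. -/
def extMap {Γ Γ' : X.C} {A : X.D.Obj Γ} {B : X.D.Obj Γ'}
    (φ : (⟨Γ, A⟩ : X.D.Total) ⟶ ⟨Γ', B⟩) : X.ext A ⟶ X.ext B := arrTop (X.χ.map φ)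

/-- The comprehension category is full: `χ` is fully faithful. -/
def IsFull : Prop := X.χ.total.Full ∧ X.χ.total.Faithful

/-- The comprehension category is univalent: its category of contexts is, and so are the fibre
categories, which expresses that the displayed category of types is univalent. -/
def IsUnivalent (r : UnivalenceReading) : Prop :=
  r.Holds X.C ∧ ∀ Γ : X.C, r.Holds (X.D.Fiber Γ)

/-- Fibrewise limits of shape `J`: the fibre categories have them and the reindexing functors
preserve them. -/
def HasFiberwiseLimits (J : Type) [Category.{0} J] : Prop :=
  (∀ Γ : X.C, HasLimitsOfShape J (X.D.Fiber Γ)) ∧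
    ∀ ⦃Γ Γ' : X.C⦄ (s : Γ ⟶ Γ'), PreservesLimitsOfShape J (DispCat.reindex X.fib s)

/-- Strong unit types: fibrewise terminal objects whose projections are invertible. -/
def HasStrongUnit : Prop :=
  X.HasFiberwiseLimits (Discrete PEmpty.{1}) ∧
    ∀ (Γ : X.C) (T : X.D.Fiber Γ), Nonempty (IsTerminal T) → IsIso (X.π T.obj)

/-- The weakening functor `π_A^* : D_Γ ⥤ D_{Γ.A}`. -/
noncomputable def weaken {Γ : X.C} (A : X.D.Obj Γ) : X.D.Fiber Γ ⥤ X.D.Fiber (X.ext A) :=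
  DispCat.reindex X.fib (X.π A)

/-- For a commutative square `t ≫ π_{A₂} = π_{A₁} ≫ s`, the canonical natural transformation
`π_{A₂}^* ⋙ t^* ⟶ s^* ⋙ π_{A₁}^*`. -/
noncomputable def weakenSquare {Γ₁ Γ₂ : X.C} {A₁ : X.D.Obj Γ₁} {A₂ : X.D.Obj Γ₂} {s : Γ₁ ⟶ Γ₂}
    {t : X.ext A₁ ⟶ X.ext A₂} (e : t ≫ X.π A₂ = X.π A₁ ≫ s) :
    TwoSquare (X.weaken A₂) (DispCat.reindex X.fib s) (DispCat.reindex X.fib t) (X.weaken A₁) :=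
  DispCat.reindexSquare X.fib e

/-- The Beck-Chevalley condition, for left adjoints `S A` of the weakening functors: for every
pullback square with sides `π_{A₁}` and `π_{A₂}`, the mate
`t^* ⋙ S A₁ ⟶ S A₂ ⋙ s^*` of the canonical natural transformation is invertible. -/
def BeckChevalley (S : ∀ {Γ : X.C} (A : X.D.Obj Γ), X.D.Fiber (X.ext A) ⥤ X.D.Fiber Γ)
    (adj : ∀ {Γ : X.C} (A : X.D.Obj Γ), S A ⊣ X.weaken A) : Prop :=
  ∀ ⦃Γ₁ Γ₂ : X.C⦄ (A₁ : X.D.Obj Γ₁) (A₂ : X.D.Obj Γ₂) (s : Γ₁ ⟶ Γ₂) (t : X.ext A₁ ⟶ X.ext A₂)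
    (h : IsPullback t (X.π A₁) (X.π A₂) s),
    ∀ B : X.D.Fiber (X.ext A₂),
      IsIso (((mateEquiv (adj A₂) (adj A₁)).symm (X.weakenSquare h.w)).app B)

/-- The morphism `Γ.A.B ⟶ Γ.(S A B)`: the comprehension of the unit `B ⟶ π_A^* (S A B)` followed by
the comprehension of the Cartesian lift of `π_A`. -/
noncomputable def pairing {Γ : X.C} (A : X.D.Obj Γ) {S : X.D.Fiber (X.ext A) ⥤ X.D.Fiber Γ}
    (adj : S ⊣ X.weaken A) (B : X.D.Fiber (X.ext A)) : X.ext B.obj ⟶ X.ext (S.obj B).obj :=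
  X.extMap (adj.unit.app B).val ≫ X.extMap (DispCat.lift X.fib (X.π A) (S.obj B))

/-- Strong dependent sums: left adjoints of the weakening functors that satisfy the Beck-Chevalley
condition, such that the morphisms `Γ.A.B ⟶ Γ.(S A B)` are invertible. -/
def HasStrongSigma : Prop :=
  ∃ (S : ∀ {Γ : X.C} (A : X.D.Obj Γ), X.D.Fiber (X.ext A) ⥤ X.D.Fiber Γ)
    (adj : ∀ {Γ : X.C} (A : X.D.Obj Γ), S A ⊣ X.weaken A),
    X.BeckChevalley S adj ∧
      ∀ ⦃Γ : X.C⦄ (A : X.D.Obj Γ) (B : X.D.Fiber (X.ext A)), IsIso (X.pairing A (adj A) B)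

/-- Democracy: every context is, up to isomorphism, the extension of the empty context by a type. -/
def IsDemocratic : Prop :=
  ∀ Γ : X.C, ∃ A : X.D.Obj (⊤_ X.C), Nonempty (Γ ≅ X.ext A)

/-- A DFL comprehension category: a democratic full univalent comprehension category with strong
unit types, fibrewise binary products, fibrewise equalizers, and strong dependent sums. -/
structure IsDFL (r : UnivalenceReading) : Prop where
  isFull : X.IsFull
  isUnivalent : X.IsUnivalent r
  hasStrongUnit : X.HasStrongUnit
  hasFiberwiseProducts : X.HasFiberwiseLimits (Discrete WalkingPair)
  hasFiberwiseEqualizers : X.HasFiberwiseLimits WalkingParallelPair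
  hasStrongSigma : X.HasStrongSigma
  isDemocratic : X.IsDemocratic

end

/-- A morphism of DFL comprehension categories: a pseudo morphism (the displayed natural
transformation `θ` is invertible) that preserves fibrewise terminal objects, binary products and
equalizers. -/
structure IsDFLHom {X Y : CompCat.{v, u}} (f : X ⟶ Y) : Prop where
  isIso_θ : ∀ A : X.D.Total, IsIso (Hom.θApp f A)
  preservesTerminal : ∀ Γ : X.C,
    PreservesLimitsOfShape (Discrete PEmpty.{1}) ((Hom.P f).fiberFunctor Γ)
  preservesProducts : ∀ Γ : X.C,
    PreservesLimitsOfShape (Discrete WalkingPair) ((Hom.P f).fiberFunctor Γ)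
  preservesEqualizers : ∀ Γ : X.C,
    PreservesLimitsOfShape WalkingParallelPair ((Hom.P f).fiberFunctor Γ)

theorem IsDFLHom.id (X : CompCat.{v, u}) : IsDFLHom (𝟙 X) where
  isIso_θ A := inferInstanceAs (IsIso (𝟙 (X.χ.tot A)))
  preservesTerminal Γ := inferInstanceAs (PreservesLimitsOfShape _ (𝟭 (X.D.Fiber Γ)))
  preservesProducts Γ := inferInstanceAs (PreservesLimitsOfShape _ (𝟭 (X.D.Fiber Γ)))
  preservesEqualizers Γ := inferInstanceAs (PreservesLimitsOfShape _ (𝟭 (X.D.Fiber Γ)))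

theorem IsDFLHom.comp {X Y Z : CompCat.{v, u}} {f : X ⟶ Y} {g : Y ⟶ Z} (hf : IsDFLHom f)
    (hg : IsDFLHom g) : IsDFLHom (f ≫ g) where
  isIso_θ A := by
    have := hf.isIso_θ A
    have : IsIso (Hom.θApp g ((Hom.P f).tot A)) := hg.isIso_θ ((Hom.P f).tot A)
    have : IsIso ((arrFunctor (Hom.F g)).map (Hom.θApp f A)) :=
      inferInstanceAs (IsIso ((arrFunctor (Hom.F g)).total.map (Hom.θApp f A)))
    exact IsIso.comp_isIso' this (hg.isIso_θ ((Hom.P f).tot A))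
  preservesTerminal Γ :=
    have := hf.preservesTerminal Γ
    have := hg.preservesTerminal ((Hom.F f).obj Γ)
    comp_preservesLimitsOfShape ((Hom.P f).fiberFunctor Γ)
      ((Hom.P g).fiberFunctor ((Hom.F f).obj Γ))
  preservesProducts Γ :=
    have := hf.preservesProducts Γ
    have := hg.preservesProducts ((Hom.F f).obj Γ)
    comp_preservesLimitsOfShape ((Hom.P f).fiberFunctor Γ)
      ((Hom.P g).fiberFunctor ((Hom.F f).obj Γ))
  preservesEqualizers Γ :=
    have := hf.preservesEqualizers Γ
    have := hg.preservesEqualizers ((Hom.F f).obj Γ)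
    comp_preservesLimitsOfShape ((Hom.P f).fiberFunctor Γ)
      ((Hom.P g).fiberFunctor ((Hom.F f).obj Γ))

end CompCat

/-! ## The two bicategories -/

/-- DFL comprehension categories and their morphisms among comprehension categories and lax
morphisms. -/
def dflData (r : UnivalenceReading) : SubData CompCat.{v, u} where
  P X := X.IsDFL r
  Q f := CompCat.IsDFLHom f
  Q_id X := CompCat.IsDFLHom.id X
  Q_comp _ _ hf hg := hf.comp hg

/-- The bicategory of DFL comprehension categories. -/
abbrev DFLCompCat (r : UnivalenceReading) := Sub (dflData.{v, u} r)

/-- Univalent categories with finite limits and functors that preserve finite limits, among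
categories and functors. -/
def finLimData (r : UnivalenceReading) : SubData Cat.{v, u} where
  P C := HasFiniteLimits C ∧ r.Holds C
  Q F := PreservesFiniteLimits F.toFunctor
  Q_id C := inferInstanceAs (PreservesFiniteLimits (𝟭 C))
  Q_comp F G hF hG := by
    have := hF
    have := hG
    exact inferInstanceAs (PreservesFiniteLimits (F.toFunctor ⋙ G.toFunctor))

/-- The bicategory of univalent categories with finite limits. -/
abbrev FinLim (r : UnivalenceReading) := Sub (finLimData.{v, u} r)


/-! ## From categories with finite limits to comprehension categories -/

theorem arr_isFibration (C : Type u) [Category.{v} C] [HasPullbacks C] : (arr C).IsFibration := by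
  intro x y f b
  refine ⟨ArrObj.mk (pullback (ArrObj.hom b) f) (pullback.snd (ArrObj.hom b) f),
    arrMk f (pullback.fst (ArrObj.hom b) f) pullback.condition, rfl, ?_⟩
  rw [arr_isCartesian_iff]
  exact IsPullback.of_hasPullback (ArrObj.hom b) f

/-- The comprehension category `id : arr C ⟶ arr C`. -/
def arrCompCat (C : Type u) [Category.{v} C] [HasFiniteLimits C] : CompCat.{v, u} where
  C := C
  D := arr C
  fib := arr_isFibration C
  χ := DispFunctor.id (arr C)
  χ_cartesian := fun _ _ _ h => h

section

variable {C C' : Type u} [Category.{v} C] [Category.{v} C'] [HasFiniteLimits C]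
  [HasFiniteLimits C']

/-- The morphism of comprehension categories induced by a functor `F` that preserves finite
limits: the functor `F`, the induced functor on arrow categories, and the identity. -/
def arrHom (F : C ⥤ C') (hF : PreservesFiniteLimits F) : arrCompCat C ⟶ arrCompCat C' where
  F := F
  preservesTerminal := hF.preservesFiniteLimits (Discrete PEmpty.{1})
  P := arrFunctor F
  P_cartesian := fun X Y φ h => by
    exact (arr_isCartesian_iff _).2 (((arr_isCartesian_iff (C := C) φ).1 h).map F)
  θ :=
    { app := fun A => 𝟙 ((arrFunctor F).tot A)
      proj_app := fun A => (Category.comp_id (𝟙 (F.obj A.base))).symm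
      naturality := fun φ =>
        (Category.comp_id ((arrFunctor F).map φ)).trans (Category.id_comp _).symm }

/-- The 2-cell induced by a natural transformation `τ`: the pair of `τ` and the natural
transformation that it induces on arrow categories. -/
def arrHom₂ {F G : C ⥤ C'} {hF : PreservesFiniteLimits F} {hG : PreservesFiniteLimits G}
    (τ : F ⟶ G) : arrHom F hF ⟶ arrHom G hG where
  τ := τ
  α := arrNatTrans τ
  comm := fun A => (Category.id_comp ((arrNatTrans τ).app A)).trans (Category.comp_id _).symm

end

section

variable (r : UnivalenceReading)

instance (X : FinLim.{v, u} r) : HasFiniteLimits X.obj := X.prop.1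

/-- The pseudofunctor that sends `C` to `id : arr C ⟶ arr C`.  Its constraints are identities. -/
def arrPseudofunctor : FinLim.{v, u} r ⥤ᵖ CompCat.{v, u} where
  obj X := arrCompCat X.obj
  map f := arrHom (Sub.Hom.hom f).toFunctor (Sub.Hom.prop f)
  map₂ σ := arrHom₂ (Sub.Hom₂.hom σ).toNatTrans
  mapId X :=
    { hom :=
        { τ := 𝟙 _
          α := { app := fun A => 𝟙 A
                 proj_app := fun A => rfl
                 naturality := fun φ => (Category.comp_id φ).trans (Category.id_comp φ).symm }
          comm := fun A => rfl }
      inv :=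
        { τ := 𝟙 _
          α := { app := fun A => 𝟙 A
                 proj_app := fun A => rfl
                 naturality := fun φ => (Category.comp_id φ).trans (Category.id_comp φ).symm }
          comm := fun A => rfl }
      hom_inv_id := by
        apply CompCat.hom₂_ext
        · intro x
          exact Category.comp_id _
        · intro A
          exact Category.comp_id _
      inv_hom_id := by
        apply CompCat.hom₂_ext
        · intro x
          exact Category.comp_id _
        · intro A
          exact Category.comp_id _ }
  mapComp f g :=
    { hom :=
        { τ := 𝟙 _
          α := { app := fun A => 𝟙 _
                 proj_app := fun A => rfl
                 naturality := fun φ => (Category.comp_id _).trans (Category.id_comp _).symm }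
          comm := fun A => by
            change 𝟙 _ ≫ 𝟙 _ = 𝟙 _ ≫ (arrFunctor (Sub.Hom.hom g).toFunctor).map
              (𝟙 ((arrFunctor (Sub.Hom.hom f).toFunctor).tot A)) ≫ 𝟙 _
            rw [DispFunctor.map_id]
            simp only [Category.comp_id] }
      inv :=
        { τ := 𝟙 _
          α := { app := fun A => 𝟙 _
                 proj_app := fun A => rfl
                 naturality := fun φ => (Category.comp_id _).trans (Category.id_comp _).symm }
          comm := fun A => by
            change ((arrFunctor (Sub.Hom.hom g).toFunctor).map
              (𝟙 ((arrFunctor (Sub.Hom.hom f).toFunctor).tot A)) ≫ 𝟙 _) ≫ 𝟙 _ = 𝟙 _ ≫ 𝟙 _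
            rw [DispFunctor.map_id, Category.comp_id] }
      hom_inv_id := by
        apply CompCat.hom₂_ext
        · intro x
          exact Category.comp_id _
        · intro A
          exact Category.comp_id _
      inv_hom_id := by
        apply CompCat.hom₂_ext
        · intro x
          exact Category.comp_id _
        · intro A
          exact Category.comp_id _ }
  map₂_id f := by
    apply CompCat.hom₂_ext
    · intro x
      rfl
    · intro A
      rfl
  map₂_comp σ ρ := by
    apply CompCat.hom₂_ext
    · intro x
      rfl
    · intro A
      rfl
  map₂_whisker_left f _ _ σ := by
    apply CompCat.hom₂_ext
    · intro x
      exact ((Category.id_comp _).trans (Category.comp_id _)).symm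
    · intro A
      exact ((Category.id_comp _).trans (Category.comp_id _)).symm
  map₂_whisker_right σ g := by
    apply CompCat.hom₂_ext
    · intro x
      exact ((Category.id_comp _).trans (Category.comp_id _)).symm
    · intro A
      exact ((Category.id_comp _).trans (Category.comp_id _)).symm
  map₂_associator f g h := by
    apply CompCat.hom₂_ext
    · intro x
      change 𝟙 _ = 𝟙 _ ≫ (Sub.Hom.hom h).toFunctor.map (𝟙 _) ≫ 𝟙 _ ≫ 𝟙 _ ≫ 𝟙 _
      simp
    · intro A
      let A₃ := (arrFunctor (Sub.Hom.hom h).toFunctor).tot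
        ((arrFunctor (Sub.Hom.hom g).toFunctor).tot ((arrFunctor (Sub.Hom.hom f).toFunctor).tot A))
      change 𝟙 A₃ = 𝟙 A₃ ≫ (arrFunctor (Sub.Hom.hom h).toFunctor).map (𝟙
        ((arrFunctor (Sub.Hom.hom g).toFunctor).tot
          ((arrFunctor (Sub.Hom.hom f).toFunctor).tot A))) ≫ 𝟙 A₃ ≫ 𝟙 A₃ ≫ 𝟙 A₃
      rw [DispFunctor.map_id]
      change 𝟙 A₃ = 𝟙 A₃ ≫ 𝟙 A₃ ≫ 𝟙 A₃ ≫ 𝟙 A₃ ≫ 𝟙 A₃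
      simp only [Category.comp_id]
  map₂_left_unitor f := by
    apply CompCat.hom₂_ext
    · intro x
      change 𝟙 _ = 𝟙 _ ≫ (Sub.Hom.hom f).toFunctor.map (𝟙 _) ≫ 𝟙 _
      simp only [Category.comp_id, Category.id_comp]
      exact (CategoryTheory.Functor.map_id _ _).symm
    · intro A
      change 𝟙 _ = 𝟙 _ ≫ (arrFunctor (Sub.Hom.hom f).toFunctor).map (𝟙 _) ≫ 𝟙 _
      simp only [Category.comp_id, Category.id_comp]
      exact (DispFunctor.map_id _ _).symm
  map₂_right_unitor f := by
    apply CompCat.hom₂_ext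
    · intro x
      change 𝟙 _ = 𝟙 _ ≫ 𝟙 _ ≫ 𝟙 _
      simp
    · intro A
      let A₁ := (arrFunctor (Sub.Hom.hom f).toFunctor).tot A
      change 𝟙 A₁ = 𝟙 A₁ ≫ 𝟙 A₁ ≫ 𝟙 A₁
      simp only [Category.comp_id]

end


/-! ## From comprehension categories to categories with finite limits -/

/-- The pseudofunctor that sends a comprehension category to its category of contexts, a 1-cell
`(F, P, θ)` to `F`, and a 2-cell `(τ, α)` to `τ`.  Its constraints are identities. -/
def contextPseudofunctor (r : UnivalenceReading) : DFLCompCat.{v, u} r ⥤ᵖ Cat.{v, u} where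
  obj X := Cat.of X.obj.C
  map f := (CompCat.Hom.F (Sub.Hom.hom f)).toCatHom
  map₂ σ := (CompCat.Hom₂.τ (Sub.Hom₂.hom σ)).toCatHom₂
  mapId X := Iso.refl _
  mapComp f g := Iso.refl _
  map₂_id f := rfl
  map₂_comp σ ρ := rfl
  map₂_whisker_left f _ _ σ := ((Category.id_comp _).trans (Category.comp_id _)).symm
  map₂_whisker_right σ g := ((Category.id_comp _).trans (Category.comp_id _)).symm
  map₂_associator f g h := by
    ext x
    change 𝟙 _ = 𝟙 _ ≫ (CompCat.Hom.F (Sub.Hom.hom h)).map (𝟙 _) ≫ 𝟙 _ ≫ 𝟙 _ ≫ 𝟙 _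
    simp
  map₂_left_unitor f := by
    ext x
    change 𝟙 _ = 𝟙 _ ≫ (CompCat.Hom.F (Sub.Hom.hom f)).map (𝟙 _) ≫ 𝟙 _
    simp only [Category.comp_id, Category.id_comp]
    exact (CategoryTheory.Functor.map_id _ _).symm
  map₂_right_unitor f := by
    ext x
    change 𝟙 _ = 𝟙 _ ≫ 𝟙 _ ≫ 𝟙 _
    simp

section

variable {r : UnivalenceReading}

/-- The pseudofunctor `H` from categories with finite limits to DFL comprehension categories. -/
def H (hH : Sub.Factors (dflData.{v, u} r) (arrPseudofunctor r)) :
    FinLim.{v, u} r ⥤ᵖ DFLCompCat.{v, u} r :=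
  Sub.lift (arrPseudofunctor r) hH

/-- The pseudofunctor `U` from DFL comprehension categories to categories with finite limits. -/
def U (hU : Sub.Factors (finLimData.{v, u} r) (contextPseudofunctor r)) :
    DFLCompCat.{v, u} r ⥤ᵖ FinLim.{v, u} r :=
  Sub.lift (contextPseudofunctor r) hU

/-! ## The pseudotransformations -/

/-- The morphism of comprehension categories from `χ : D ⟶ arr C` to `id : arr C ⟶ arr C` given by
the identity of `C`, the displayed functor `χ`, and the identity. -/
def comprehensionHom (X : CompCat.{v, u}) [HasFiniteLimits X.C] : X ⟶ arrCompCat X.C where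
  F := 𝟭 X.C
  preservesTerminal := (CompCat.Hom.id X).preservesTerminal
  P := X.χ
  P_cartesian := X.χ_cartesian
  θ :=
    { app := fun A => 𝟙 (X.χ.tot A)
      proj_app := fun A => (Category.comp_id (𝟙 A.base)).symm
      naturality := fun φ =>
        (Category.comp_id (X.χ.map φ)).trans (Category.id_comp (X.χ.map φ)).symm }

/-- The 2-cell whose components are those of the natural transformation `θ` of `f`. -/
def comprehensionSquare {X Y : CompCat.{v, u}} [HasFiniteLimits X.C] [HasFiniteLimits Y.C]
    (f : X ⟶ Y) (hF : PreservesFiniteLimits (CompCat.Hom.F f)) :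
    comprehensionHom X ≫ arrHom (CompCat.Hom.F f) hF ⟶ f ≫ comprehensionHom Y where
  τ := 𝟙 (CompCat.Hom.F f)
  α :=
    { app := fun A => CompCat.Hom.θApp f A
      proj_app := fun A => CompCat.Hom.arrBase_θApp f A
      naturality := fun φ => CompCat.Hom.θApp_naturality f φ }
  comm := fun A => by
    let S := (arrFunctor (CompCat.Hom.F f)).tot (X.χ.tot A)
    let T := Y.χ.tot ((CompCat.Hom.P f).tot A)
    change ((arrFunctor (CompCat.Hom.F f)).map (𝟙 (X.χ.tot A)) ≫ 𝟙 S) ≫ CompCat.Hom.θApp f A =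
      𝟙 S ≫ CompCat.Hom.θApp f A ≫ 𝟙 T
    rw [DispFunctor.map_id, Category.comp_id]
    exact congrArg (𝟙 S ≫ ·) (Category.comp_id (CompCat.Hom.θApp f A)).symm

/-- The 2-cell `comprehensionSquare` is invertible if `θ` is. -/
noncomputable def comprehensionIso {X Y : CompCat.{v, u}} [HasFiniteLimits X.C]
    [HasFiniteLimits Y.C] (f : X ⟶ Y) (hF : PreservesFiniteLimits (CompCat.Hom.F f))
    (h : ∀ A : X.D.Total, IsIso (CompCat.Hom.θApp f A)) :
    comprehensionHom X ≫ arrHom (CompCat.Hom.F f) hF ≅ f ≫ comprehensionHom Y :=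
  CompCat.isoMk (comprehensionSquare f hF)
    (fun x => inferInstanceAs (IsIso (𝟙 ((CompCat.Hom.F f).obj x)))) h

theorem hasFiniteLimits (hU : Sub.Factors (finLimData.{v, u} r) (contextPseudofunctor r))
    (X : DFLCompCat.{v, u} r) : HasFiniteLimits X.obj.C := (hU.obj X).1

/-- The pseudotransformation `ξ` from `H` followed by `U` to the identity.  Its components and its
naturality constraints are identities. -/
def ξ (hH : Sub.Factors (dflData.{v, u} r) (arrPseudofunctor r))
    (hU : Sub.Factors (finLimData.{v, u} r) (contextPseudofunctor r)) :
    Pseudofunctor.StrongTrans ((H hH).comp (U hU)) (Pseudofunctor.id (FinLim.{v, u} r)) where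
  app C := 𝟙 C
  naturality f := (ρ_ f) ≪≫ (λ_ f).symm
  naturality_naturality {C C' f g} σ := by
    apply Sub.hom₂_ext
    apply Cat.Hom₂.ext
    ext x
    let t : (Sub.Hom.hom f).toFunctor.obj x ⟶ (Sub.Hom.hom g).toFunctor.obj x :=
      (Sub.Hom₂.hom σ).toNatTrans.app x
    change t ≫ 𝟙 _ ≫ 𝟙 _ = (𝟙 _ ≫ 𝟙 _) ≫ t
    simp
  naturality_id C := by
    apply Sub.hom₂_ext
    apply Cat.Hom₂.ext
    ext x
    change (𝟙 x ≫ 𝟙 x) ≫ 𝟙 x = (𝟙 x ≫ 𝟙 x) ≫ 𝟙 x ≫ 𝟙 x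
    simp
  naturality_comp {C C' C''} f g := by
    apply Sub.hom₂_ext
    apply Cat.Hom₂.ext
    ext x
    let y := (Sub.Hom.hom g).toFunctor.obj ((Sub.Hom.hom f).toFunctor.obj x)
    change (𝟙 y ≫ 𝟙 y) ≫ 𝟙 y = (𝟙 y ≫ 𝟙 y) ≫ 𝟙 y ≫ (𝟙 y ≫ 𝟙 y) ≫ 𝟙 y ≫
      (Sub.Hom.hom g).toFunctor.map (𝟙 _ ≫ 𝟙 _) ≫ 𝟙 y
    rw [Category.comp_id (𝟙 ((Sub.Hom.hom f).toFunctor.obj x)), CategoryTheory.Functor.map_id]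
    change (𝟙 y ≫ 𝟙 y) ≫ 𝟙 y = (𝟙 y ≫ 𝟙 y) ≫ 𝟙 y ≫ (𝟙 y ≫ 𝟙 y) ≫ 𝟙 y ≫ 𝟙 y ≫ 𝟙 y
    simp only [Category.comp_id]

theorem inv_comp_aux {A : Type u} [Category.{v} A] {S W T : A} {a : S ⟶ W} {ψ : W ⟶ T} {κ : S ⟶ T}
    {b : W ⟶ S} {i : T ⟶ T} [IsIso ψ] [IsIso κ] (h : κ = a ≫ ψ) (h' : a ≫ b = 𝟙 S) (h'' : i = 𝟙 T) :
    inv κ ≫ 𝟙 S ≫ 𝟙 S = i ≫ 𝟙 T ≫ inv ψ ≫ 𝟙 W ≫ b ≫ 𝟙 S := by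
  subst h''
  rw [IsIso.inv_comp_eq]
  simp [h, h']

/-- The pseudotransformation `ζ` from the identity to `U` followed by `H`.  Its component at
`χ : D ⟶ arr C` is the identity of `C` together with `χ`, and its naturality constraint at a
morphism `(F, P, θ)` is given by the identity of `F` and by `θ`. -/
noncomputable def ζ (hH : Sub.Factors (dflData.{v, u} r) (arrPseudofunctor r))
    (hU : Sub.Factors (finLimData.{v, u} r) (contextPseudofunctor r))
    (hζ : ∀ X : DFLCompCat.{v, u} r, 
      CompCat.IsDFLHom (@comprehensionHom X.obj (hasFiniteLimits hU X))) :
    Pseudofunctor.StrongTrans (Pseudofunctor.id (DFLCompCat.{v, u} r)) ((U hU).comp (H hH)) where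
  app X := Sub.Hom.mk (@comprehensionHom X.obj (hasFiniteLimits hU X)) (hζ X)
  naturality {X Y} f := (Sub.isoMk (@comprehensionIso X.obj Y.obj (hasFiniteLimits hU X)
    (hasFiniteLimits hU Y) (Sub.Hom.hom f) (hU.map f) (Sub.Hom.prop f).isIso_θ)).symm
  naturality_naturality {X Y f g} σ := by
    apply Sub.hom₂_ext
    apply CompCat.hom₂_ext
    · intro x
      let t := (CompCat.Hom₂.τ (Sub.Hom₂.hom σ)).app x
      change t ≫ inv (𝟙 _) = inv (𝟙 _) ≫ t
      simp
    · intro A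
      have := (Sub.Hom.prop f).isIso_θ A
      have := (Sub.Hom.prop g).isIso_θ A
      have e := CompCat.Hom₂.comm (Sub.Hom₂.hom σ) A
      change Y.obj.χ.map ((CompCat.Hom₂.α (Sub.Hom₂.hom σ)).app A) ≫
          inv (CompCat.Hom.θApp (Sub.Hom.hom g) A) =
        inv (CompCat.Hom.θApp (Sub.Hom.hom f) A) ≫
          (arrNatTrans (CompCat.Hom₂.τ (Sub.Hom₂.hom σ))).app (X.obj.χ.tot A)
      rw [IsIso.comp_inv_eq, Category.assoc, IsIso.eq_inv_comp]
      exact e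
  naturality_id X := by
    apply Sub.hom₂_ext
    apply CompCat.hom₂_ext
    · intro x
      change inv (𝟙 x) ≫ 𝟙 x ≫ 𝟙 x = 𝟙 x ≫ 𝟙 x ≫ 𝟙 x
      simp
    · intro (A : X.obj.D.Total)
      let T := X.obj.χ.tot A
      change inv (𝟙 T) ≫ 𝟙 T ≫ 𝟙 T = X.obj.χ.map (𝟙 A) ≫ 𝟙 T ≫ 𝟙 T
      rw [IsIso.inv_id, DispFunctor.map_id]
  naturality_comp {X Y Z} f g := by
    apply Sub.hom₂_ext
    apply CompCat.hom₂_ext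
    · intro x
      let F := CompCat.Hom.F (Sub.Hom.hom f)
      let G := CompCat.Hom.F (Sub.Hom.hom g)
      let y := G.obj (F.obj x)
      change inv (𝟙 y) ≫ 𝟙 y ≫ 𝟙 y =
        𝟙 y ≫ 𝟙 y ≫ inv (𝟙 y) ≫ 𝟙 y ≫ G.map (inv (𝟙 (F.obj x))) ≫ 𝟙 y
      rw [IsIso.inv_id, IsIso.inv_id, CategoryTheory.Functor.map_id]
      change 𝟙 y ≫ 𝟙 y ≫ 𝟙 y = 𝟙 y ≫ 𝟙 y ≫ 𝟙 y ≫ 𝟙 y ≫ 𝟙 y ≫ 𝟙 y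
      simp only [Category.comp_id]
    · intro A
      let F := CompCat.Hom.F (Sub.Hom.hom f)
      let G := CompCat.Hom.F (Sub.Hom.hom g)
      let B := (CompCat.Hom.P (Sub.Hom.hom f)).tot A
      let T := Z.obj.χ.tot ((CompCat.Hom.P (Sub.Hom.hom g)).tot B)
      let T' := (arrFunctor G).tot ((arrFunctor F).tot (X.obj.χ.tot A))
      have hf : IsIso (CompCat.Hom.θApp (Sub.Hom.hom f) A) := (Sub.Hom.prop f).isIso_θ A
      have hg : IsIso (CompCat.Hom.θApp (Sub.Hom.hom g) B) := (Sub.Hom.prop g).isIso_θ B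
      have hfg : IsIso (CompCat.Hom.θApp (Sub.Hom.hom (f ≫ g)) A) :=
        (Sub.Hom.prop (f ≫ g)).isIso_θ A
      let φ : (arrFunctor F).tot (X.obj.χ.tot A) ⟶ Y.obj.χ.tot B :=
        CompCat.Hom.θApp (Sub.Hom.hom f) A
      let ψ : (arrFunctor G).tot (Y.obj.χ.tot B) ⟶ T := CompCat.Hom.θApp (Sub.Hom.hom g) B
      have hφ : IsIso φ := hf
      have hψ : IsIso ψ := hg
      let κ : T' ⟶ T := (arrFunctor G).map φ ≫ ψ
      have hκ : IsIso κ := hfg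
      have e : (arrFunctor G).map φ ≫ (arrFunctor G).map (inv φ) = 𝟙 T' := by
        rw [← DispFunctor.map_comp, IsIso.hom_inv_id, DispFunctor.map_id]
      exact inv_comp_aux (κ := κ) (ψ := ψ) rfl e (DispFunctor.map_id Z.obj.χ _)

end

/-! ## Biequivalences -/

/-- A 1-cell of a bicategory is an adjoint equivalence. -/
def IsAdjointEquivalence {B : Type u} [Bicategory.{w, v} B] {a b : B} (f : a ⟶ b) : Prop :=
  ∃ e : Bicategory.Equivalence a b, e.hom = f

section

open scoped Pseudofunctor.StrongTrans

/-- The pseudofunctors `F` and `G` and the pseudotransformations `η : id ⟶ G.comp F` and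
`θ : F.comp G ⟶ id` (compositions in diagrammatic order) form a biequivalence: `η` and `θ` are
adjoint equivalences in the bicategories of pseudofunctors, pseudotransformations and
modifications. -/
structure IsBiequivalence {A : Type u₁} [Bicategory.{w₁, v₁} A] {B : Type u₂}
    [Bicategory.{w₂, v₂} B] (F : A ⥤ᵖ B) (G : B ⥤ᵖ A)
    (η : Pseudofunctor.StrongTrans (Pseudofunctor.id B) (G.comp F))
    (θ : Pseudofunctor.StrongTrans (F.comp G) (Pseudofunctor.id A)) : Prop where
  unit : IsAdjointEquivalence (B := B ⥤ᵖ B) (a := Pseudofunctor.id B) (b := G.comp F) η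
  counit : IsAdjointEquivalence (B := A ⥤ᵖ A) (a := F.comp G) (b := Pseudofunctor.id A) θ

end

end DFL

/-!
The pseudofunctor `H` lands in DFL comprehension categories because the fibre of the arrow category
over `x` is the slice over `x`, where limits are available, and because reindexing along `f` has
composition with `f` as a left adjoint (`arrSumAdj`). The latter makes reindexing preserve limits
and provides the dependent sums; their Beck-Chevalley comparison is the comparison between two
pullbacks of one cospan (`isIso_arrSum_mate`).

For `U` and `ζ`, the main point is that every morphism `s : x ⟶ y` of contexts of a DFL
comprehension category is isomorphic to a projection (`CompCat.exists_ext_iso`): by democracy `x`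
and `y` are given by types `B` and `A` in the empty context, and `s` is the projection of the type
`Σ (b : B), s b = y` in context `y`, which is built from a dependent sum and an equalizer type.
Projections have pullbacks, given by comprehensions of Cartesian morphisms, and these are preserved
by pseudo morphisms; hence contexts have finite limits and the functors of contexts preserve them.
It also follows that the comprehension functor from the fibre over `x` to the slice over `x` is an
equivalence (`CompCat.IsDFL.isEquivalence_χFiber`), so it preserves limits and `ζ` is well defined,
and that `χ` has an inverse up to isomorphism, chosen in `CompCat.IsDFL.displayHom`.

The coherence of the biequivalence rests on the fact that `U` is fully faithful on 2-cells: as `χ`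
is fully faithful and the comparison `θ` of a 1-cell is invertible, a 2-cell `(τ, α)` is determined
by `τ`, and every `τ` extends to a 2-cell (`dfl_hom₂_ext`, `dflIsoMk`). All the functors of contexts
involved in the inverse of `ζ` and in the unit and counit are identities, so each of the coherence
equations reduces to an equation between composites of identities. It remains to adjointify the
resulting equivalences, and to evaluate them at an object for the pointwise statements.
-/

namespace DFL

/-! ### Comparison of Cartesian morphisms -/

namespace DispCat

variable {C : Type u} [Category.{v} C] {D : DispCat.{w, v, u} C}

/-- A morphism over an identity that becomes Cartesian after composition with a Cartesian lift is
invertible: it compares two Cartesian lifts of the same morphism. -/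
theorem isIso_of_comp_isCartesian {x : C} {a b : D.Fiber x} {Z : D.Total} (m : a ⟶ b)
    {φ : b.tot ⟶ Z} (hφ : D.IsCartesian φ) (h : D.IsCartesian (m.val ≫ φ)) : IsIso m := by
  have e : D.proj (m.val ≫ φ) = D.proj φ := by
    rw [D.proj_comp, m.proj_val]; exact Category.id_comp _
  have e' : D.proj φ = 𝟙 x ≫ D.proj (m.val ≫ φ) := by
    rw [e]; exact (Category.id_comp _).symm
  let n : b ⟶ a := ⟨h.factor (𝟙 x) φ e', h.proj_factor _ _ e'⟩
  have hn : n.val ≫ m.val ≫ φ = φ := h.factor_comp _ _ e'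
  refine ⟨n, ?_, ?_⟩
  · refine fiber_hom_ext (h.hom_ext ?_ ?_)
    · exact (m ≫ n).proj_val.trans (D.proj_id a.tot).symm
    · simp only [fiber_comp_val, fiber_id_val, Category.assoc, hn, Category.id_comp]
  · refine fiber_hom_ext (hφ.hom_ext ?_ ?_)
    · exact (n ≫ m).proj_val.trans (D.proj_id b.tot).symm
    · simp only [fiber_comp_val, fiber_id_val, Category.assoc, hn, Category.id_comp]

end DispCat

/-! ### Fibres of the arrow category -/

section

variable {C : Type u} [Category.{v} C]

theorem arrFiber_comm {x : C} {a b : (arr C).Fiber x} (φ : a ⟶ b) :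
    arrTop φ.val ≫ ArrObj.hom b.obj = ArrObj.hom a.obj := by
  have h := arr_comm φ.val
  rw [show arrBase φ.val = 𝟙 x from φ.proj_val] at h
  exact h.trans (Category.comp_id _)

/-- The equivalence from the fibre of the arrow category over `x` to the slice over `x`. -/
def arrFiberToOver (x : C) : (arr C).Fiber x ⥤ Over x where
  obj a := Over.mk (ArrObj.hom a.obj)
  map φ := Over.homMk (arrTop φ.val) (arrFiber_comm φ)
  map_id _ := rfl
  map_comp _ _ := rfl

/-- A morphism of the fibre of the arrow category over `x`: a commutative triangle. -/
def arrFiberHom {x : C} {a b : (arr C).Fiber x} (t : ArrObj.dom a.obj ⟶ ArrObj.dom b.obj)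
    (h : t ≫ ArrObj.hom b.obj = ArrObj.hom a.obj) : a ⟶ b where
  val := arrMk (𝟙 x) t (h.trans (Category.comp_id _).symm)
  proj_val := rfl

theorem arrFiber_hom_ext {x : C} {a b : (arr C).Fiber x} {φ ψ : a ⟶ b}
    (h : arrTop φ.val = arrTop ψ.val) : φ = ψ :=
  DispCat.fiber_hom_ext (arr_hom_ext (φ.proj_val.trans ψ.proj_val.symm) h)

instance (x : C) : (arrFiberToOver x).Faithful where
  map_injective h := arrFiber_hom_ext (congrArg CommaMorphism.left h)

instance (x : C) : (arrFiberToOver x).Full where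
  map_surjective g := ⟨arrFiberHom g.left (Over.w g), rfl⟩

instance (x : C) : (arrFiberToOver x).EssSurj where
  mem_essImage Y := ⟨⟨ArrObj.mk Y.left Y.hom⟩, ⟨Over.isoMk (Iso.refl _) (Category.id_comp _)⟩⟩

instance (x : C) : (arrFiberToOver x).IsEquivalence where

instance [HasFiniteLimits C] (x : C) : HasFiniteLimits ((arr C).Fiber x) where
  out _ _ _ := Adjunction.hasLimitsOfShape_of_equivalence (arrFiberToOver x)

/-- The functor that sends an object of the fibre over `x`, a morphism into `x`, to its domain. -/
abbrev arrFiberDom (x : C) : (arr C).Fiber x ⥤ C := arrFiberToOver x ⋙ Over.forget x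

/-- The identity of `x` is terminal in the fibre over `x`. -/
def arrFiberIdIsTerminal (x : C) : IsTerminal (⟨ArrObj.mk x (𝟙 x)⟩ : (arr C).Fiber x) :=
  IsTerminal.ofUniqueHom
    (fun a => arrFiberHom (b := ⟨ArrObj.mk x (𝟙 x)⟩) (ArrObj.hom a.obj) (Category.comp_id _))
    (fun _ φ => arrFiber_hom_ext ((Category.comp_id _).symm.trans (arrFiber_comm φ)))

/-- Pullbacks in a fibre of the arrow category are computed on domains, so a functor that preserves
pullbacks induces functors of fibres that do; they preserve the identities, which are terminal. -/
theorem preservesFiniteLimits_arrFunctor_fiberFunctor [HasFiniteLimits C] {C' : Type u₁}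
    [Category.{v₁} C'] (F : C ⥤ C') [PreservesFiniteLimits F] (x : C) :
    PreservesFiniteLimits ((arrFunctor F).fiberFunctor x) := by
  have : PreservesLimitsOfShape (Discrete PEmpty.{1}) ((arrFunctor F).fiberFunctor x) := by
    have : PreservesLimit (Functor.empty.{0} _) ((arrFunctor F).fiberFunctor x) :=
      preservesLimit_of_preserves_limit_cone (arrFiberIdIsTerminal x)
        ((isLimitMapConeEmptyConeEquiv _ _).symm
          ((arrFiberIdIsTerminal (F.obj x)).ofIso
            (eqToIso (congrArg (fun t => (⟨ArrObj.mk _ t⟩ : (arr C').Fiber (F.obj x)))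
              (F.map_id x).symm))))
    exact preservesLimitsOfShape_pempty_of_preservesTerminal _
  have : PreservesLimitsOfShape WalkingCospan
      ((arrFunctor F).fiberFunctor x ⋙ arrFiberDom (F.obj x)) :=
    inferInstanceAs (PreservesLimitsOfShape WalkingCospan (arrFiberDom x ⋙ F))
  have := preservesLimitsOfShape_of_reflects_of_preserves (J := WalkingCospan)
    ((arrFunctor F).fiberFunctor x) (arrFiberDom (F.obj x))
  exact preservesFiniteLimits_of_preservesTerminal_and_pullbacks _

/-! ### Composition and reindexing in the arrow category -/

/-- Composition with `f : x ⟶ y`, from the fibre over `x` to the fibre over `y`. -/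
def arrSum {x y : C} (f : x ⟶ y) : (arr C).Fiber x ⥤ (arr C).Fiber y where
  obj a := ⟨ArrObj.mk (ArrObj.dom a.obj) (ArrObj.hom a.obj ≫ f)⟩
  map {_ b} φ := arrFiberHom (b := ⟨ArrObj.mk (ArrObj.dom b.obj) (ArrObj.hom b.obj ≫ f)⟩)
    (arrTop φ.val) ((Category.assoc _ _ _).symm.trans (congrArg (· ≫ f) (arrFiber_comm φ)))
  map_id _ := arrFiber_hom_ext rfl
  map_comp _ _ := arrFiber_hom_ext rfl

/-- The morphism over `f` from `a` to its composite with `f` that is the identity on domains. -/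
def arrSumι {x y : C} (f : x ⟶ y) (a : (arr C).Fiber x) : a.tot ⟶ ((arrSum f).obj a).tot :=
  arrMk (Y := ((arrSum f).obj a).tot) f (𝟙 (ArrObj.dom a.obj)) (Category.id_comp _)

/-- The factorization through `arrSumι f a` of a morphism over `f`. -/
def arrSumDesc {x y : C} (f : x ⟶ y) {a : (arr C).Fiber x} {b : (arr C).Fiber y}
    (φ : a.tot ⟶ b.tot) (e : (arr C).proj φ = f) : (arrSum f).obj a ⟶ b :=
  arrFiberHom (a := (arrSum f).obj a) (arrTop φ)
    ((arr_comm φ).trans (congrArg (ArrObj.hom a.obj ≫ ·) e))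

theorem arrSumι_desc {x y : C} (f : x ⟶ y) {a : (arr C).Fiber x} {b : (arr C).Fiber y}
    (φ : a.tot ⟶ b.tot) (e : (arr C).proj φ = f) : arrSumι f a ≫ (arrSumDesc f φ e).val = φ :=
  arr_hom_ext ((Category.comp_id f).trans e.symm) (Category.id_comp _)

theorem arrSum_hom_ext {x y : C} (f : x ⟶ y) {a : (arr C).Fiber x} {b : (arr C).Fiber y}
    {φ ψ : (arrSum f).obj a ⟶ b} (h : arrSumι f a ≫ φ.val = arrSumι f a ≫ ψ.val) : φ = ψ := by
  apply arrFiber_hom_ext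
  exact (Category.id_comp _).symm.trans ((congrArg arrTop h).trans (Category.id_comp _))

theorem arrSumι_naturality {x y : C} (f : x ⟶ y) {a b : (arr C).Fiber x} (φ : a ⟶ b) :
    arrSumι f a ≫ ((arrSum f).map φ).val = φ.val ≫ arrSumι f b := by
  apply arr_hom_ext
  · change f ≫ 𝟙 y = arrBase φ.val ≫ f
    rw [show arrBase φ.val = 𝟙 x from φ.proj_val]
    exact (Category.comp_id f).trans (Category.id_comp f).symm
  · exact (Category.id_comp _).trans (Category.comp_id _).symm

/-- Morphisms from the composite of `a` with `f` to `b`, and morphisms from `a` to the reindexing of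
`b` along `f`, both correspond to the morphisms from `a` to `b` over `f`. -/
noncomputable def arrSumHomEquiv (h : (arr C).IsFibration) {x y : C} (f : x ⟶ y)
    (a : (arr C).Fiber x) (b : (arr C).Fiber y) :
    ((arrSum f).obj a ⟶ b) ≃ (a ⟶ DispCat.pull h f b) where
  toFun φ := DispCat.factorLift h f (arrSumι f a ≫ φ.val) (by
    rw [DispCat.proj_comp, φ.proj_val]; exact Category.comp_id f)
  invFun ψ := arrSumDesc f (ψ.val ≫ DispCat.lift h f b) (by
    rw [DispCat.proj_comp, ψ.proj_val, DispCat.proj_lift]; exact Category.id_comp f)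
  left_inv φ := arrSum_hom_ext f (by rw [arrSumι_desc, DispCat.factorLift_lift])
  right_inv ψ := DispCat.pull_hom_ext h f (by rw [DispCat.factorLift_lift, arrSumι_desc])

theorem arrSumHomEquiv_lift (h : (arr C).IsFibration) {x y : C} (f : x ⟶ y)
    {a : (arr C).Fiber x} {b : (arr C).Fiber y} (φ : (arrSum f).obj a ⟶ b) :
    (arrSumHomEquiv h f a b φ).val ≫ DispCat.lift h f b = arrSumι f a ≫ φ.val :=
  DispCat.factorLift_lift h f _ (by
    rw [DispCat.proj_comp, φ.proj_val]; exact Category.comp_id f)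

theorem arrSumι_homEquiv_symm (h : (arr C).IsFibration) {x y : C} (f : x ⟶ y)
    {a : (arr C).Fiber x} {b : (arr C).Fiber y} (ψ : a ⟶ DispCat.pull h f b) :
    arrSumι f a ≫ ((arrSumHomEquiv h f a b).symm ψ).val = ψ.val ≫ DispCat.lift h f b :=
  arrSumι_desc f _ (by
    rw [DispCat.proj_comp, ψ.proj_val, DispCat.proj_lift]; exact Category.id_comp f)

/-- Composition with `f` is left adjoint to reindexing along `f`. -/
noncomputable def arrSumAdj (h : (arr C).IsFibration) {x y : C} (f : x ⟶ y) :
    arrSum f ⊣ DispCat.reindex h f :=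
  Adjunction.mkOfHomEquiv
    { homEquiv := arrSumHomEquiv h f
      homEquiv_naturality_left_symm := fun {a a' b} φ (ψ : a' ⟶ DispCat.pull h f b) => by
        apply arrSum_hom_ext
        refine (arrSumι_homEquiv_symm h f (φ ≫ ψ)).trans ?_
        rw [DispCat.fiber_comp_val, DispCat.fiber_comp_val, ← Category.assoc (arrSumι f a),
          arrSumι_naturality, Category.assoc, Category.assoc]
        exact congrArg (φ.val ≫ ·) (arrSumι_homEquiv_symm h f ψ).symm
      homEquiv_naturality_right := fun {a b b'} φ ψ => by
        apply DispCat.pull_hom_ext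
        change (arrSumHomEquiv h f a b' (φ ≫ ψ)).val ≫ DispCat.lift h f b' =
          (arrSumHomEquiv h f a b φ ≫ DispCat.pullMap h f ψ).val ≫ DispCat.lift h f b'
        rw [arrSumHomEquiv_lift, DispCat.fiber_comp_val, DispCat.fiber_comp_val, Category.assoc,
          DispCat.pullMap_lift, ← Category.assoc, ← Category.assoc, arrSumHomEquiv_lift] }

theorem arrSumAdj_unit_lift (h : (arr C).IsFibration) {x y : C} (f : x ⟶ y)
    (a : (arr C).Fiber x) :
    ((arrSumAdj h f).unit.app a).val ≫ DispCat.lift h f ((arrSum f).obj a) = arrSumι f a := by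
  rw [arrSumAdj, Adjunction.mkOfHomEquiv_unit_app]
  exact (arrSumHomEquiv_lift h f (𝟙 ((arrSum f).obj a))).trans (Category.comp_id _)

/-- If `u₁` and `u₂` are the units of the adjunctions between composition and reindexing, then the
mate `m` of the comparison `reindexSquareApp` lies under the lift of `t` to `b`. -/
theorem arrSumι_comp_lift (h : (arr C).IsFibration) {x₁ y₁ x₂ y₂ : C} {p₁ : x₁ ⟶ y₁}
    {p₂ : x₂ ⟶ y₂} {s : y₁ ⟶ y₂} {t : x₁ ⟶ x₂} (e : t ≫ p₂ = p₁ ≫ s) {b : (arr C).Fiber x₂}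
    {u₁ : DispCat.pull h t b ⟶ DispCat.pull h p₁ ((arrSum p₁).obj (DispCat.pull h t b))}
    {u₂ : b ⟶ DispCat.pull h p₂ ((arrSum p₂).obj b)}
    (hu₁ : u₁.val ≫ DispCat.lift h p₁ _ = arrSumι p₁ _)
    (hu₂ : u₂.val ≫ DispCat.lift h p₂ _ = arrSumι p₂ _)
    {m : (arrSum p₁).obj (DispCat.pull h t b) ⟶ DispCat.pull h s ((arrSum p₂).obj b)}
    (hm : DispCat.pullMap h t u₂ ≫ DispCat.reindexSquareApp h e ((arrSum p₂).obj b) =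
      u₁ ≫ DispCat.pullMap h p₁ m) :
    arrSumι p₁ (DispCat.pull h t b) ≫ m.val ≫ DispCat.lift h s ((arrSum p₂).obj b) =
      DispCat.lift h t b ≫ arrSumι p₂ b := by
  have h₃ := congrArg (fun φ => φ.val ≫ DispCat.lift h p₁ _ ≫ DispCat.lift h s _) hm
  simp only [DispCat.fiber_comp_val, Category.assoc, DispCat.reindexSquareApp_lift,
    DispCat.pullMap_lift_assoc] at h₃
  rw [← hu₁, ← hu₂, Category.assoc, h₃]

/-- The Beck-Chevalley comparison for composition functors is the comparison between two pullbacks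
of the same cospan. -/
theorem isIso_arrSum_mate (h : (arr C).IsFibration) {x₁ y₁ x₂ y₂ : C} {p₁ : x₁ ⟶ y₁}
    {p₂ : x₂ ⟶ y₂} {s : y₁ ⟶ y₂} {t : x₁ ⟶ x₂} (sq : IsPullback t p₁ p₂ s)
    (b : (arr C).Fiber x₂) :
    IsIso (((CategoryTheory.mateEquiv (arrSumAdj h p₂) (arrSumAdj h p₁)).symm
      (DispCat.reindexSquare h sq.w : TwoSquare (DispCat.reindex h p₂) (DispCat.reindex h s)
        (DispCat.reindex h t) (DispCat.reindex h p₁))).app b) := by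
  suffices key : ∀ m : (arrSum p₁).obj (DispCat.pull h t b) ⟶ DispCat.pull h s ((arrSum p₂).obj b),
      DispCat.pullMap h t ((arrSumAdj h p₂).unit.app b) ≫
          DispCat.reindexSquareApp h sq.w ((arrSum p₂).obj b) =
        (arrSumAdj h p₁).unit.app (DispCat.pull h t b) ≫ DispCat.pullMap h p₁ m → IsIso m from
    key _ (unit_mateEquiv_symm (arrSumAdj h p₂) (arrSumAdj h p₁)
      (DispCat.reindexSquare h sq.w : TwoSquare (DispCat.reindex h p₂) (DispCat.reindex h s)
        (DispCat.reindex h t) (DispCat.reindex h p₁)) b)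
  intro m h₁
  have h₂ := arrSumι_comp_lift h sq.w (arrSumAdj_unit_lift h p₁ (DispCat.pull h t b))
    (arrSumAdj_unit_lift h p₂ b) h₁
  refine DispCat.isIso_of_comp_isCartesian m (DispCat.lift_isCartesian h s _) ?_
  have h₄ : arrTop (m.val ≫ DispCat.lift h s ((arrSum p₂).obj b)) =
      arrTop (DispCat.lift h t b) :=
    (Category.id_comp _).symm.trans ((congrArg arrTop h₂).trans (Category.comp_id _))
  have h₅ : arrBase (m.val ≫ DispCat.lift h s ((arrSum p₂).obj b)) = s := by
    rw [← arr_proj, DispCat.proj_comp, m.proj_val, DispCat.proj_lift]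
    exact Category.id_comp s
  rw [arr_isCartesian_iff, h₄, h₅]
  have h₆ := (arr_isCartesian_iff _).1 (DispCat.lift_isCartesian h t b)
  rw [← arr_proj, DispCat.proj_lift] at h₆
  exact h₆.paste_vert sq

/-! ### The comprehension category of the arrow category -/

theorem preservesLimitsOfShape_arr_reindex (h : (arr C).IsFibration) (J : Type) [SmallCategory J]
    {x y : C} (f : x ⟶ y) : PreservesLimitsOfShape J (DispCat.reindex h f) :=
  (arrSumAdj h f).rightAdjoint_preservesLimits.preservesLimitsOfShape

theorem hasLimitsOfShape_arr_fiber [HasFiniteLimits C] (J : Type) [SmallCategory J]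
    [FinCategory J] (x : C) : HasLimitsOfShape J ((arr C).Fiber x) :=
  inferInstance

theorem arr_hasFiberwiseLimits [HasFiniteLimits C] (J : Type) [SmallCategory J] [FinCategory J] :
    (arrCompCat C).HasFiberwiseLimits J :=
  ⟨hasLimitsOfShape_arr_fiber (C := C) J,
    fun _ _ f => preservesLimitsOfShape_arr_reindex (C := C) (arr_isFibration C) J f⟩

theorem isIso_hom_of_isTerminal {x : C} {a : (arr C).Fiber x} (ha : IsTerminal a) :
    IsIso (ArrObj.hom a.obj) := by
  let e := ha.uniqueUpToIso (arrFiberIdIsTerminal x)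
  have h₁ : arrTop e.hom.val ≫ 𝟙 x = ArrObj.hom a.obj := arrFiber_comm e.hom
  refine ⟨arrTop e.inv.val, ?_, arrFiber_comm e.inv⟩
  rw [← h₁, Category.comp_id]
  exact congrArg (fun φ : a ⟶ a => arrTop φ.val) e.hom_inv_id

theorem arr_hasStrongUnit [HasFiniteLimits C] : (arrCompCat C).HasStrongUnit :=
  ⟨arr_hasFiberwiseLimits _, fun _ _ ⟨h⟩ => isIso_hom_of_isTerminal (C := C) h⟩

theorem isIso_arrTop_arrSumAdj_unit_lift (h : (arr C).IsFibration) {x y : C} (f : x ⟶ y)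
    (a : (arr C).Fiber x) :
    IsIso (arrTop (((arrSumAdj h f).unit.app a).val ≫ DispCat.lift h f ((arrSum f).obj a))) := by
  rw [arrSumAdj_unit_lift]
  exact inferInstanceAs (IsIso (𝟙 (ArrObj.dom a.obj)))

theorem arr_hasStrongSigma [HasFiniteLimits C] : (arrCompCat C).HasStrongSigma := by
  have hfib := arr_isFibration C
  refine ⟨fun A => arrSum (C := C) (ArrObj.hom A),
    fun A => arrSumAdj (C := C) hfib (ArrObj.hom A), ?_, ?_⟩
  · intro x₁ x₂ A₁ A₂ s t h B
    exact isIso_arrSum_mate hfib h B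
  · exact fun x A B => isIso_arrTop_arrSumAdj_unit_lift (C := C) hfib (ArrObj.hom A) B

theorem arr_fiber_holds {r : UnivalenceReading} (h : r.Holds C) (x : C) :
    r.Holds ((arr C).Fiber x) := by
  cases r with
  | homotopical => trivial
  | literal =>
    rintro ⟨⟨a, f⟩⟩ ⟨⟨b, g⟩⟩
    refine ⟨fun _ _ _ => rfl, fun e => ?_⟩
    obtain ⟨rfl, he⟩ := (h a b).2 ((arrFiberDom x).mapIso e)
    have he' : arrTop e.hom.val = 𝟙 a := congrArg Iso.hom he.symm
    have hg : g = f := by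
      have := arrFiber_comm e.hom
      rw [he'] at this
      exact (Category.id_comp g).symm.trans this
    subst hg
    exact ⟨rfl, Iso.ext (arrFiber_hom_ext he'.symm)⟩

/-- The comprehension category `id : arr C ⟶ arr C` is DFL. -/
theorem arrCompCat_isDFL [HasFiniteLimits C] {r : UnivalenceReading} (h : r.Holds C) :
    (arrCompCat C).IsDFL r where
  isFull := ⟨⟨fun φ => ⟨φ, rfl⟩⟩, ⟨fun e => e⟩⟩
  isUnivalent := ⟨h, arr_fiber_holds h⟩
  hasStrongUnit := arr_hasStrongUnit
  hasFiberwiseProducts := arr_hasFiberwiseLimits _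
  hasFiberwiseEqualizers := arr_hasFiberwiseLimits _
  hasStrongSigma := arr_hasStrongSigma
  isDemocratic := fun x => ⟨ArrObj.mk x (terminal.from x), ⟨Iso.refl x⟩⟩

theorem isDFLHom_arrHom {C' : Type u} [Category.{v} C'] [HasFiniteLimits C] [HasFiniteLimits C']
    (F : C ⥤ C') (hF : PreservesFiniteLimits F) : CompCat.IsDFLHom (arrHom F hF) where
  isIso_θ A := inferInstanceAs (IsIso (𝟙 ((arrFunctor F).tot A)))
  preservesTerminal (x : C) :=
    (preservesFiniteLimits_arrFunctor_fiberFunctor F x).preservesFiniteLimits _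
  preservesProducts (x : C) :=
    (preservesFiniteLimits_arrFunctor_fiberFunctor F x).preservesFiniteLimits _
  preservesEqualizers (x : C) :=
    (preservesFiniteLimits_arrFunctor_fiberFunctor F x).preservesFiniteLimits _

end

/-! ### Context extensions of a full comprehension category -/

namespace DispCat

variable {C : Type u} [Category.{v} C] {D : DispCat.{w, v, u} C}

theorem isCartesian_of_isIso {X Y : D.Total} (φ : X ⟶ Y) [IsIso φ] : D.IsCartesian φ := by
  intro W g ψ e
  refine ⟨ψ ≫ inv φ, ⟨?_, by simp⟩, ?_⟩
  · rw [D.proj_comp, e, Category.assoc, ← D.proj_comp, IsIso.hom_inv_id, D.proj_id]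
    exact Category.comp_id g
  · rintro κ ⟨-, rfl⟩
    simp

end DispCat

namespace CompCat

variable {X : CompCat.{v, u}}

theorem arrBase_χ_map {A B : X.D.Total} (φ : A ⟶ B) : arrBase (X.χ.map φ) = X.D.proj φ :=
  X.χ.proj_map φ

theorem extMap_π {A B : X.D.Total} (φ : A ⟶ B) :
    X.extMap φ ≫ X.π B.fib = X.π A.fib ≫ X.D.proj φ :=
  (arr_comm (X.χ.map φ)).trans (congrArg (X.π A.fib ≫ ·) (arrBase_χ_map φ))

theorem extMap_comp {A B E : X.D.Total} (φ : A ⟶ B) (ψ : B ⟶ E) :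
    X.extMap (φ ≫ ψ) = X.extMap φ ≫ X.extMap ψ :=
  congrArg arrTop (X.χ.map_comp φ ψ)

theorem extMap_id (A : X.D.Total) : X.extMap (𝟙 A) = 𝟙 (X.ext A.fib) :=
  congrArg arrTop (X.χ.map_id A)

theorem extMap_val_π {x : X.C} {a b : X.D.Fiber x} (φ : a ⟶ b) :
    X.extMap φ.val ≫ X.π b.obj = X.π a.obj := by
  refine (extMap_π φ.val).trans ?_
  rw [φ.proj_val]
  exact Category.comp_id _

instance isIso_extMap_val {x : X.C} {a b : X.D.Fiber x} (φ : a ⟶ b) [IsIso φ] :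
    IsIso (X.extMap φ.val) := by
  refine ⟨X.extMap (inv φ).val, ?_, ?_⟩
  · rw [← extMap_comp, ← DispCat.fiber_comp_val, IsIso.hom_inv_id]
    exact extMap_id _
  · rw [← extMap_comp, ← DispCat.fiber_comp_val, IsIso.inv_hom_id]
    exact extMap_id _

/-- The comprehension of a Cartesian morphism is a pullback square. -/
theorem isPullback_extMap {A B : X.D.Total} {φ : A ⟶ B} (h : X.D.IsCartesian φ) :
    IsPullback (X.extMap φ) (X.π A.fib) (X.π B.fib) (X.D.proj φ) := by
  have := (arr_isCartesian_iff _).1 (X.χ_cartesian φ h)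
  rw [arrBase_χ_map] at this
  exact this

theorem isPullback_extMap_lift {x y : X.C} (s : x ⟶ y) (b : X.D.Fiber y) :
    IsPullback (X.extMap (DispCat.lift X.fib s b)) (X.π (DispCat.pull X.fib s b).obj)
      (X.π b.obj) s := by
  have := isPullback_extMap (DispCat.lift_isCartesian X.fib s b)
  rw [DispCat.proj_lift] at this
  exact this

theorem IsFull.hom_ext (h : X.IsFull) {A B : X.D.Total} {φ ψ : A ⟶ B}
    (h₁ : X.D.proj φ = X.D.proj ψ) (h₂ : X.extMap φ = X.extMap ψ) : φ = ψ :=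
  h.2.map_injective (arr_hom_ext ((arrBase_χ_map φ).trans (h₁.trans (arrBase_χ_map ψ).symm)) h₂)

/-- A morphism of a full comprehension category is given by a commutative square between
projections. -/
theorem IsFull.exists_hom (h : X.IsFull) {A B : X.D.Total} (s : A.base ⟶ B.base)
    (t : X.ext A.fib ⟶ X.ext B.fib) (e : t ≫ X.π B.fib = X.π A.fib ≫ s) :
    ∃ φ : A ⟶ B, X.D.proj φ = s ∧ X.extMap φ = t := by
  obtain ⟨φ, hφ⟩ := h.1.map_surjective
    (arrMk (X := X.χ.tot A) (Y := X.χ.tot B) s t e : X.χ.total.obj A ⟶ X.χ.total.obj B)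
  exact ⟨φ, (arrBase_χ_map φ).symm.trans (congrArg arrBase hφ), congrArg arrTop hφ⟩

theorem pairing_π {x : X.C} {A : X.D.Obj x} {S : X.D.Fiber (X.ext A) ⥤ X.D.Fiber x}
    (adj : S ⊣ X.weaken A) (B : X.D.Fiber (X.ext A)) :
    X.pairing A adj B ≫ X.π (S.obj B).obj = X.π B.obj ≫ X.π A := by
  have h (u : B ⟶ DispCat.pull X.fib (X.π A) (S.obj B)) :
      (X.extMap u.val ≫ X.extMap (DispCat.lift X.fib (X.π A) (S.obj B))) ≫ X.π (S.obj B).obj =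
        X.π B.obj ≫ X.π A := by
    rw [Category.assoc, (isPullback_extMap_lift _ _).w, ← Category.assoc, extMap_val_π]
  exact h (adj.unit.app B)

/-! ### Every morphism of contexts is a projection -/

section

variable (hfull : X.IsFull) (hunit : X.HasStrongUnit)
  (heq : X.HasFiberwiseLimits WalkingParallelPair)

include hfull hunit heq

/-- The equalizer type of two terms: two parallel morphisms `a` and `b` from `x` to the extension of
the empty context by a type amount to two morphisms from the unit type to a type in context `x`, and
the projection of their equalizer is an equalizer of `a` and `b`. -/
theorem exists_equalizer_type {x : X.C} {A : X.D.Obj (⊤_ X.C)} (a b : x ⟶ X.ext A) :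
    ∃ E : X.D.Obj x, X.π E ≫ a = X.π E ≫ b ∧
      ∀ ⦃z : X.C⦄ (t : z ⟶ x), t ≫ a = t ≫ b → ∃! m : z ⟶ X.ext E, m ≫ X.π E = t := by
  obtain ⟨⟨hT, hT'⟩, hU⟩ := hunit
  obtain ⟨hE, hE'⟩ := heq
  have := hT x
  have := hE x
  let U : X.D.Fiber x := ⊤_ (X.D.Fiber x)
  let A' : X.D.Fiber (⊤_ X.C) := ⟨A⟩
  have term (c : x ⟶ X.ext A) : ∃ φ : U.tot ⟶ A'.tot,
      X.D.proj φ = terminal.from x ∧ X.extMap φ = X.π U.obj ≫ c :=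
    hfull.exists_hom (A := U.tot) (B := A'.tot) (terminal.from x) (X.π U.obj ≫ c)
      (terminal.hom_ext _ _)
  obtain ⟨α, hα, hα'⟩ := term a
  obtain ⟨β, hβ, hβ'⟩ := term b
  -- The terms of type `A` in context `x` that correspond to `a` and `b`.
  let α₀ := DispCat.factorLift X.fib (terminal.from x) α hα
  let β₀ := DispCat.factorLift X.fib (terminal.from x) β hβ
  have hα₀ : α₀.val ≫ DispCat.lift X.fib (terminal.from x) A' = α := DispCat.factorLift_lift _ _ _ _
  have hβ₀ : β₀.val ≫ DispCat.lift X.fib (terminal.from x) A' = β := DispCat.factorLift_lift _ _ _ _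
  let E := equalizer α₀ β₀
  let ι : E ⟶ U := equalizer.ι α₀ β₀
  have hι : ι ≫ α₀ = ι ≫ β₀ := equalizer.condition _ _
  refine ⟨E.obj, ?_, fun z t ht => ?_⟩
  · have h₁ : ι.val ≫ α = ι.val ≫ β := by
      have := congrArg (fun φ => φ.val ≫ DispCat.lift X.fib (terminal.from x) A') hι
      simpa only [DispCat.fiber_comp_val, Category.assoc, hα₀, hβ₀] using this
    have h₂ := congrArg X.extMap h₁
    rw [extMap_comp, extMap_comp, hα', hβ', ← Category.assoc, ← Category.assoc,
      extMap_val_π] at h₂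
    exact h₂
  · -- As `t ≫ a = t ≫ b`, the two terms agree after reindexing along `t`, so that the reindexed
    -- equalizer is invertible and `t` has a unique lift along the projection of the equalizer type.
    have := hT z
    have h₁ : DispCat.pullMap X.fib t α₀ = DispCat.pullMap X.fib t β₀ := by
      apply DispCat.pull_hom_ext
      rw [DispCat.pullMap_lift, DispCat.pullMap_lift]
      apply (DispCat.lift_isCartesian X.fib (terminal.from x) A').hom_ext
      · rw [X.D.proj_comp, X.D.proj_comp, α₀.proj_val, β₀.proj_val]
      · rw [Category.assoc, Category.assoc, hα₀, hβ₀]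
        apply hfull.hom_ext
        · exact terminal.hom_ext _ _
        · rw [extMap_comp, extMap_comp, hα', hβ', ← Category.assoc, ← Category.assoc, extMap_π,
            DispCat.proj_lift, Category.assoc, Category.assoc, ht]
    have := hE' t
    have hι' : IsIso ((DispCat.reindex X.fib t).map ι) :=
      isIso_limit_cone_parallelPair_of_eq h₁
        (isLimitForkMapOfIsLimit (DispCat.reindex X.fib t) hι (equalizerIsEqualizer α₀ β₀))
    have hU' : IsIso (X.π (DispCat.pull X.fib t U).obj) := by
      have := hT' t
      exact hU z _ ⟨terminalIsTerminal.isTerminalObj (DispCat.reindex X.fib t) U⟩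
    have hπ : IsIso (X.π (DispCat.pull X.fib t E).obj) := by
      have h₂ := extMap_val_π (DispCat.pullMap X.fib t ι)
      rw [← h₂]
      have : IsIso (DispCat.pullMap X.fib t ι) := hι'
      exact IsIso.comp_isIso' inferInstance hU'
    have hP := isPullback_extMap_lift t E
    refine ⟨inv (X.π (DispCat.pull X.fib t E).obj) ≫ X.extMap (DispCat.lift X.fib t E), ?_, ?_⟩
    · dsimp only
      rw [Category.assoc, hP.w, IsIso.inv_hom_id_assoc]
    · intro m hm
      have h₂ : hP.lift m (𝟙 z) (by rw [hm, Category.id_comp]) =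
          inv (X.π (DispCat.pull X.fib t E).obj) := by
        rw [← cancel_mono (X.π (DispCat.pull X.fib t E).obj), hP.lift_snd, IsIso.inv_hom_id]
      rw [← h₂, hP.lift_fst]

/-- In a DFL comprehension category, every morphism `s : x ⟶ y` is isomorphic to a projection.  By
democracy `y` is the extension of the empty context by a type, and so is `x`, by `B` say; then `s`
is the projection of the type `Σ (b : B), s b = y` in context `y`, where equality stands for an
equalizer type. -/
theorem exists_ext_iso (hsigma : X.HasStrongSigma) (hdem : X.IsDemocratic) {x y : X.C}
    (s : x ⟶ y) : ∃ (A : X.D.Obj y) (e : x ≅ X.ext A), e.hom ≫ X.π A = s := by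
  obtain ⟨A, ⟨i⟩⟩ := hdem y
  obtain ⟨B, ⟨j⟩⟩ := hdem x
  have hP := isPullback_extMap_lift (terminal.from y) (⟨B⟩ : X.D.Fiber (⊤_ X.C))
  let W := DispCat.pull X.fib (terminal.from y) (⟨B⟩ : X.D.Fiber (⊤_ X.C))
  let q : X.ext W.obj ⟶ X.ext B := X.extMap (DispCat.lift X.fib (terminal.from y) ⟨B⟩)
  let p : X.ext W.obj ⟶ y := X.π W.obj
  obtain ⟨E, hE, hE'⟩ := exists_equalizer_type hfull hunit heq (p ≫ i.hom)
    (q ≫ j.inv ≫ s ≫ i.hom)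
  let t : x ⟶ X.ext W.obj := hP.lift j.hom s (terminal.hom_ext _ _)
  have htq : t ≫ q = j.hom := hP.lift_fst _ _ _
  have htp : t ≫ p = s := hP.lift_snd _ _ _
  obtain ⟨m, hm, -⟩ := hE' t (by
    rw [reassoc_of% htq, reassoc_of% htp, j.hom_inv_id_assoc])
  -- `E` is an equalizer of `p` and `q ≫ j.inv ≫ s`, the graph of `s`, hence isomorphic to `x`.
  have hEs : X.π E ≫ q ≫ j.inv ≫ s = X.π E ≫ p := by
    rw [← cancel_mono i.hom]
    simpa only [Category.assoc] using hE.symm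
  have hmono {z : X.C} {k l : z ⟶ X.ext E} (h : k ≫ X.π E = l ≫ X.π E) : k = l :=
    (hE' (l ≫ X.π E) (by rw [Category.assoc, Category.assoc, hE])).unique h rfl
  let e : x ≅ X.ext E :=
    { hom := m
      inv := X.π E ≫ q ≫ j.inv
      hom_inv_id := by rw [reassoc_of% hm, reassoc_of% htq, j.hom_inv_id]
      inv_hom_id := by
        apply hmono
        rw [Category.assoc, hm, Category.id_comp]
        apply hP.hom_ext
        · change _ ≫ q = _ ≫ q
          simp only [Category.assoc, htq, j.inv_hom_id, Category.comp_id]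
        · change _ ≫ p = _ ≫ p
          simp only [Category.assoc, htp, hEs] }
  obtain ⟨S, adj, -, hS⟩ := hsigma
  let E' : X.D.Fiber (X.ext W.obj) := ⟨E⟩
  have hpair : IsIso (X.pairing W.obj (adj W.obj) E') := hS W.obj E'
  refine ⟨((S W.obj).obj E').obj, e ≪≫ asIso (X.pairing W.obj (adj W.obj) E'), ?_⟩
  have h₁ : X.pairing W.obj (adj W.obj) E' ≫ X.π ((S W.obj).obj E').obj = X.π E ≫ p :=
    pairing_π (adj W.obj) E'
  rw [Iso.trans_hom, asIso_hom, Category.assoc, h₁]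
  change m ≫ X.π E ≫ p = s
  rw [reassoc_of% hm, htp]

end

namespace IsDFL

variable {r : UnivalenceReading} (hX : X.IsDFL r)

include hX

theorem exists_ext_iso {x y : X.C} (s : x ⟶ y) :
    ∃ (A : X.D.Obj y) (e : x ≅ X.ext A), e.hom ≫ X.π A = s :=
  CompCat.exists_ext_iso hX.isFull hX.hasStrongUnit hX.hasFiberwiseEqualizers hX.hasStrongSigma
    hX.isDemocratic s

theorem hasPullbacks : HasPullbacks X.C := by
  have (x y z : X.C) (s : x ⟶ z) (t : y ⟶ z) : HasPullback s t := by
    obtain ⟨A, e, rfl⟩ := hX.exists_ext_iso s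
    exact ((isPullback_extMap_lift t ⟨A⟩).of_iso (Iso.refl _) e.symm (Iso.refl _) (Iso.refl _)
      (fst' := X.extMap (DispCat.lift X.fib t ⟨A⟩) ≫ e.inv)
      (snd' := X.π (DispCat.pull X.fib t ⟨A⟩).obj) (by simp) (by simp) (by simp) (by simp)).hasPullback
  exact hasPullbacks_of_hasLimit_cospan _

/-- A DFL comprehension category has finite limits in its category of contexts: pullbacks, because
every morphism is isomorphic to a projection and projections can be pulled back. -/
theorem hasFiniteLimits : HasFiniteLimits X.C :=
  have := hX.hasPullbacks
  hasFiniteLimits_of_hasTerminal_and_pullbacks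

end IsDFL

section

variable {Y : CompCat.{v, u}} {f : X ⟶ Y}

/-- The functor of contexts of a pseudo morphism preserves the pullback squares that are
comprehensions of Cartesian morphisms. -/
theorem isPullback_map_extMap (hf : ∀ A : X.D.Total, IsIso (Hom.θApp f A)) {A B : X.D.Total}
    {φ : A ⟶ B} (hφ : X.D.IsCartesian φ) :
    IsPullback ((Hom.F f).map (X.extMap φ)) ((Hom.F f).map (X.π A.fib)) ((Hom.F f).map (X.π B.fib))
      ((Hom.F f).map (X.D.proj φ)) := by
  have h₁ := Hom.θApp_naturality f φ
  have := hf A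
  have := hf B
  rw [← IsIso.eq_comp_inv, Category.assoc] at h₁
  have h₂ : (arr Y.C).IsCartesian ((arrFunctor (Hom.F f)).map (X.χ.map φ)) := by
    rw [h₁]
    exact (DispCat.isCartesian_of_isIso _).comp
      ((Y.χ_cartesian _ ((Hom.P_cartesian f) _ hφ)).comp (DispCat.isCartesian_of_isIso _))
  have h₃ := (arr_isCartesian_iff _).1 h₂
  rw [← arrBase_χ_map φ]
  exact h₃

theorem IsDFL.preservesFiniteLimits {r : UnivalenceReading} (hX : X.IsDFL r) (hf : IsDFLHom f) :
    PreservesFiniteLimits (Hom.F f) := by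
  have := hX.hasPullbacks
  have := Hom.preservesTerminal f
  have : PreservesLimitsOfShape WalkingCospan (Hom.F f) := by
    refine preservesLimitsOfShape_walkingCospan_of_forall_isPullback fun x y z s t _ => ?_
    obtain ⟨A, e, rfl⟩ := hX.exists_ext_iso s
    refine ⟨_, X.extMap (DispCat.lift X.fib t ⟨A⟩) ≫ e.inv, X.π _,
      (isPullback_extMap_lift t ⟨A⟩).of_iso (Iso.refl _) e.symm (Iso.refl _) (Iso.refl _)
      (by simp) (by simp) (by simp) (by simp), ?_⟩
    have h := isPullback_map_extMap hf.isIso_θ (DispCat.lift_isCartesian X.fib t ⟨A⟩)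
    rw [DispCat.proj_lift] at h
    refine h.of_iso (Iso.refl _) ((Hom.F f).mapIso e.symm) (Iso.refl _) (Iso.refl _)
      (by simp) (by simp) ?_ (by simp)
    rw [Functor.mapIso_hom, ← Functor.map_comp, Iso.symm_hom, e.inv_hom_id_assoc]
    exact Category.comp_id _
  exact preservesFiniteLimits_of_preservesTerminal_and_pullbacks _

end

/-! ### The comprehension functors of fibres -/

section

/-- The action of `χ` on the fibres over `x`. -/
abbrev χFiber (X : CompCat.{v, u}) (x : X.C) : X.D.Fiber x ⥤ (arr X.C).Fiber x :=
  X.χ.fiberFunctor x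

theorem IsFull.full_χFiber (h : X.IsFull) (x : X.C) : (X.χFiber x).Full where
  map_surjective {a b} φ := by
    obtain ⟨ψ, hψ, hψ'⟩ := h.exists_hom (A := a.tot) (B := b.tot) (𝟙 x) (arrTop φ.val)
      ((arrFiber_comm φ).trans (Category.comp_id _).symm)
    exact ⟨⟨ψ, hψ⟩, arrFiber_hom_ext hψ'⟩

theorem IsFull.faithful_χFiber (h : X.IsFull) (x : X.C) : (X.χFiber x).Faithful where
  map_injective {a b φ ψ} e := DispCat.fiber_hom_ext <|
    h.hom_ext (φ.proj_val.trans ψ.proj_val.symm)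
      (congrArg (fun φ : (X.χFiber x).obj a ⟶ (X.χFiber x).obj b => arrTop φ.val) e)

/-- In a DFL comprehension category, the fibre over `x` is equivalent to the slice over `x`. -/
theorem IsDFL.isEquivalence_χFiber {r : UnivalenceReading} (hX : X.IsDFL r) (x : X.C) :
    (X.χFiber x).IsEquivalence where
  full := hX.isFull.full_χFiber x
  faithful := hX.isFull.faithful_χFiber x
  essSurj := ⟨fun a => by
    obtain ⟨A, e, he⟩ := hX.exists_ext_iso (ArrObj.hom a.obj)
    let i : (X.χFiber x).obj ⟨A⟩ ⟶ a := arrFiberHom (a := (X.χFiber x).obj ⟨A⟩) e.inv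
      ((Iso.inv_comp_eq e).2 he.symm)
    let j : a ⟶ (X.χFiber x).obj ⟨A⟩ := arrFiberHom (b := (X.χFiber x).obj ⟨A⟩) e.hom he
    exact ⟨⟨A⟩, ⟨⟨i, j, arrFiber_hom_ext e.inv_hom_id, arrFiber_hom_ext e.hom_inv_id⟩⟩⟩⟩

theorem IsDFL.isDFLHom_comprehensionHom [HasFiniteLimits X.C] {r : UnivalenceReading}
    (hX : X.IsDFL r) : IsDFLHom (comprehensionHom X) := by
  have key (J : Type) [SmallCategory J] (x : X.C) : PreservesLimitsOfShape J (X.χFiber x) :=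
    have := hX.isEquivalence_χFiber x
    inferInstance
  exact ⟨fun A => inferInstanceAs (IsIso (𝟙 (X.χ.tot A))), key _, key _, key _⟩

end

end CompCat

/-! ### The pseudofunctors are well defined -/

theorem factors_arrPseudofunctor (r : UnivalenceReading) :
    Sub.Factors (dflData.{v, u} r) (arrPseudofunctor r) where
  obj C := arrCompCat_isDFL C.prop.2
  map F := isDFLHom_arrHom _ F.prop

theorem factors_contextPseudofunctor (r : UnivalenceReading) :
    Sub.Factors (finLimData.{v, u} r) (contextPseudofunctor r) where
  obj X := ⟨CompCat.IsDFL.hasFiniteLimits X.prop, X.prop.isUnivalent.1⟩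
  map {X _} f := CompCat.IsDFL.preservesFiniteLimits X.prop f.prop

/-! ### 2-cells between pseudo morphisms into a full comprehension category -/

namespace CompCat

variable {X Y : CompCat.{v, u}}

/-- A preimage under `χ` of a morphism of the arrow category. -/
noncomputable def IsFull.preimage (h : X.IsFull) {A B : X.D.Total}
    (φ : X.χ.tot A ⟶ X.χ.tot B) : A ⟶ B := (h.1.map_surjective (X := A) (Y := B) φ).choose

theorem IsFull.map_preimage (h : X.IsFull) {A B : X.D.Total} (φ : X.χ.tot A ⟶ X.χ.tot B) :
    X.χ.map (h.preimage φ) = φ := (h.1.map_surjective (X := A) (Y := B) φ).choose_spec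

theorem IsFull.map_injective (h : X.IsFull) {A B : X.D.Total} {φ ψ : A ⟶ B}
    (e : X.χ.map φ = X.χ.map ψ) : φ = ψ := h.2.map_injective e

theorem IsFull.proj_preimage (h : X.IsFull) {A B : X.D.Total} (φ : X.χ.tot A ⟶ X.χ.tot B) :
    X.D.proj (h.preimage φ) = arrBase φ := by
  rw [← arrBase_χ_map, h.map_preimage]

section

variable {f g : X ⟶ Y}

/-- A 2-cell into a full comprehension category is determined by its natural transformation of
contexts, as its comprehension is. -/
theorem IsFull.hom₂_ext (h : Y.IsFull) (hf : ∀ A, IsIso (Hom.θApp f A)) {σ ρ : f ⟶ g}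
    (e : Hom₂.τ σ = Hom₂.τ ρ) : σ = ρ := by
  refine CompCat.hom₂_ext (fun x => by rw [e]) (fun A => h.map_injective ?_)
  have := hf A
  rw [← cancel_epi (Hom.θApp f A)]
  exact (Hom₂.comm σ A).trans (by rw [e]; exact (Hom₂.comm ρ A).symm)

/-- The 2-cell into a full comprehension category given by a natural transformation of contexts. -/
noncomputable def IsFull.hom₂Mk (h : Y.IsFull) (hf : ∀ A, IsIso (Hom.θApp f A))
    (τ : Hom.F f ⟶ Hom.F g) : f ⟶ g where
  τ := τ
  α :=
    { app := fun A =>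
        have := hf A
        h.preimage (A := (Hom.P f).tot A) (B := (Hom.P g).tot A)
          (inv (Hom.θApp f A) ≫ (arrNatTrans τ).app (X.χ.tot A) ≫ Hom.θApp g A)
      proj_app := fun A => by
        have := hf A
        rw [h.proj_preimage, arrBase_comp, arrBase_comp, Hom.arrBase_θApp]
        have e : arrBase (inv (Hom.θApp f A)) = 𝟙 _ := by
          have e₁ := congrArg arrBase (IsIso.hom_inv_id (Hom.θApp f A))
          rw [arrBase_comp, Hom.arrBase_θApp] at e₁
          exact (Category.id_comp _).symm.trans e₁
        rw [e]
        exact (Category.id_comp _).trans (Category.comp_id _)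
      naturality := fun {A B} φ => by
        have := hf A
        have := hf B
        apply h.map_injective
        rw [DispFunctor.map_comp, DispFunctor.map_comp, h.map_preimage, h.map_preimage,
          ← cancel_epi (Hom.θApp f A), ← Category.assoc, ← Hom.θApp_naturality f φ]
        simp only [Category.assoc, IsIso.hom_inv_id_assoc]
        rw [← Hom.θApp_naturality g φ, ← Category.assoc, ← Category.assoc]
        exact congrArg (· ≫ _) ((arrNatTrans τ).naturality (X.χ.map φ)) }
  comm := fun A => by
    have := hf A
    rw [h.map_preimage, IsIso.hom_inv_id_assoc]

/-- The invertible 2-cell between pseudo morphisms into a full comprehension category given by a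
natural isomorphism of contexts. -/
noncomputable def IsFull.isoMk (h : Y.IsFull) (hf : ∀ A, IsIso (Hom.θApp f A))
    (hg : ∀ A, IsIso (Hom.θApp g A)) (i : Hom.F f ≅ Hom.F g) : f ≅ g where
  hom := h.hom₂Mk hf i.hom
  inv := h.hom₂Mk hg i.inv
  hom_inv_id := h.hom₂_ext hf i.hom_inv_id
  inv_hom_id := h.hom₂_ext hg i.inv_hom_id

end

/-! ### The inverse of the comprehension morphism -/

namespace IsDFL

variable {r : UnivalenceReading} (hX : X.IsDFL r)

/-- A type whose projection is isomorphic to a given morphism into `x`. -/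
noncomputable def display {x : X.C} (a : (arr X.C).Obj x) : X.D.Obj x :=
  (hX.exists_ext_iso (ArrObj.hom a)).choose

/-- The isomorphism over the identity of a morphism `a` with the projection of `display a`. -/
noncomputable def displayIso (a : (arr X.C).Total) :
    a ≅ X.χ.tot ⟨a.base, hX.display a.fib⟩ where
  hom := arrMk (Y := X.χ.tot ⟨a.base, hX.display a.fib⟩) (𝟙 a.base)
    (hX.exists_ext_iso (ArrObj.hom a.fib)).choose_spec.choose.hom
    ((hX.exists_ext_iso (ArrObj.hom a.fib)).choose_spec.choose_spec.trans (Category.comp_id _).symm)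
  inv := arrMk (X := X.χ.tot ⟨a.base, hX.display a.fib⟩) (𝟙 a.base)
    (hX.exists_ext_iso (ArrObj.hom a.fib)).choose_spec.choose.inv
    (((Iso.inv_comp_eq _).2 (hX.exists_ext_iso (ArrObj.hom a.fib)).choose_spec.choose_spec.symm).trans
      (Category.comp_id _).symm)
  hom_inv_id := arr_hom_ext (Category.comp_id _) (Iso.hom_inv_id _)
  inv_hom_id := arr_hom_ext (Category.comp_id _) (Iso.inv_hom_id _)

/-- The displayed functor from the arrow category to types that is inverse to `χ`. -/
noncomputable def displayFunctor : DispFunctor (arr X.C) X.D (𝟭 X.C) where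
  obj a := hX.display a
  map {a b} φ := hX.isFull.preimage ((hX.displayIso a).inv ≫ φ ≫ (hX.displayIso b).hom)
  proj_map {a b} φ := by
    rw [hX.isFull.proj_preimage]
    exact (Category.id_comp _).trans (Category.comp_id _)
  map_id a := hX.isFull.map_injective (by
    rw [hX.isFull.map_preimage, DispFunctor.map_id, Category.id_comp, Iso.inv_hom_id])
  map_comp φ ψ := hX.isFull.map_injective (by
    rw [DispFunctor.map_comp, hX.isFull.map_preimage, hX.isFull.map_preimage,
      hX.isFull.map_preimage]
    simp)

theorem χ_map_displayFunctor {a b : (arr X.C).Total} (φ : a ⟶ b) :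
    X.χ.map (hX.displayFunctor.map φ) = (hX.displayIso a).inv ≫ φ ≫ (hX.displayIso b).hom :=
  hX.isFull.map_preimage _

theorem displayIso_naturality {a b : (arr X.C).Total} (φ : a ⟶ b) :
    φ ≫ (hX.displayIso b).hom = (hX.displayIso a).hom ≫ X.χ.map (hX.displayFunctor.map φ) := by
  refine Eq.trans ?_ (congrArg ((hX.displayIso a).hom ≫ ·) (hX.χ_map_displayFunctor φ)).symm
  exact (Iso.hom_inv_id_assoc _ _).symm

end IsDFL

/-- The comprehension of a full comprehension category reflects Cartesian morphisms. -/
theorem IsFull.isCartesian_of_map (h : X.IsFull) {A B : X.D.Total} {φ : A ⟶ B}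
    (hφ : (arr X.C).IsCartesian (X.χ.map φ)) : X.D.IsCartesian φ := by
  intro W g ψ e
  obtain ⟨κ, ⟨h₁, h₂⟩, h₃⟩ := hφ (X.χ.tot W) g (X.χ.map ψ) (by
    rw [X.χ.proj_map, X.χ.proj_map]; exact e)
  refine ⟨h.preimage κ, ⟨(h.proj_preimage κ).trans h₁, h.map_injective ?_⟩, ?_⟩
  · rw [DispFunctor.map_comp, h.map_preimage, h₂]
  · rintro l ⟨l₁, l₂⟩
    apply h.map_injective
    rw [h.map_preimage]
    exact h₃ _ ⟨(X.χ.proj_map l).trans l₁, by rw [← DispFunctor.map_comp, l₂]⟩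

theorem IsDFL.displayFunctor_isCartesian {r : UnivalenceReading} (hX : X.IsDFL r) :
    hX.displayFunctor.IsCartesian := fun a b φ h => hX.isFull.isCartesian_of_map (by
  rw [χ_map_displayFunctor]
  have h₁ := @DispCat.isCartesian_of_isIso _ _ _ _ _ _ (hX.displayIso a).isIso_inv
  have h₂ := @DispCat.isCartesian_of_isIso _ _ _ _ _ _ (hX.displayIso b).isIso_hom
  exact h₁.comp (h.comp h₂))

/-- The morphism of comprehension categories inverse to `comprehensionHom X`. -/
noncomputable def IsDFL.displayHom [HasFiniteLimits X.C] {r : UnivalenceReading}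
    (hX : X.IsDFL r) : arrCompCat X.C ⟶ X where
  F := 𝟭 X.C
  preservesTerminal := (CompCat.Hom.id X).preservesTerminal
  P := hX.displayFunctor
  P_cartesian := hX.displayFunctor_isCartesian
  θ :=
    { app := fun a => (hX.displayIso a).hom
      proj_app := fun a => (Category.comp_id (𝟙 a.base)).symm
      naturality := fun φ => hX.displayIso_naturality φ }

theorem IsDFL.isDFLHom_displayHom [HasFiniteLimits X.C] {r : UnivalenceReading} (hX : X.IsDFL r) :
    IsDFLHom hX.displayHom := by
  have key (J : Type) [SmallCategory J] (x : X.C) :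
      PreservesLimitsOfShape J (hX.displayFunctor.fiberFunctor x) := by
    have := hX.isEquivalence_χFiber x
    let G : (arr X.C).Fiber x ⥤ X.D.Fiber x := hX.displayFunctor.fiberFunctor x
    let hom (a : (arr X.C).Fiber x) : a ⟶ (G ⋙ X.χFiber x).obj a :=
      ⟨(hX.displayIso a.tot).hom, rfl⟩
    let inv (a : (arr X.C).Fiber x) : (G ⋙ X.χFiber x).obj a ⟶ a :=
      ⟨(hX.displayIso a.tot).inv, rfl⟩
    let i : 𝟭 _ ≅ G ⋙ X.χFiber x := NatIso.ofComponents
      (fun a => ⟨hom a, inv a, DispCat.fiber_hom_ext (hX.displayIso a.tot).hom_inv_id,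
        DispCat.fiber_hom_ext (hX.displayIso a.tot).inv_hom_id⟩)
      (fun φ => DispCat.fiber_hom_ext (hX.displayIso_naturality φ.val))
    have : PreservesLimitsOfShape J (G ⋙ X.χFiber x) := preservesLimitsOfShape_of_natIso i
    exact preservesLimitsOfShape_of_reflects_of_preserves G (X.χFiber x)
  exact ⟨fun a => (hX.displayIso a).isIso_hom, key _, key _, key _⟩

end CompCat

/-! ### The inverse of `ζ` -/

section

variable {r : UnivalenceReading}

/-- The natural transformation of contexts of a 2-cell of DFL comprehension categories. -/
abbrev contextTrans {X Y : DFLCompCat.{v, u} r} {f g : X ⟶ Y} (σ : f ⟶ g) :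
    CompCat.Hom.F (Sub.Hom.hom f) ⟶ CompCat.Hom.F (Sub.Hom.hom g) :=
  CompCat.Hom₂.τ (Sub.Hom₂.hom σ)

/-- A 2-cell of DFL comprehension categories is determined by its natural transformation of
contexts. -/
theorem dfl_hom₂_ext {X Y : DFLCompCat.{v, u} r} {f g : X ⟶ Y} {σ ρ : f ⟶ g}
    (h : ∀ x, (contextTrans σ).app x = (contextTrans ρ).app x) : σ = ρ :=
  Sub.hom₂_ext <| Y.prop.isFull.hom₂_ext (Sub.Hom.prop f).isIso_θ <| NatTrans.ext <| funext h

/-- The invertible 2-cell of DFL comprehension categories given by a natural isomorphism of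
contexts. -/
noncomputable def dflIsoMk {X Y : DFLCompCat.{v, u} r} {f g : X ⟶ Y}
    (i : CompCat.Hom.F (Sub.Hom.hom f) ≅ CompCat.Hom.F (Sub.Hom.hom g)) : f ≅ g :=
  Sub.isoMk (Y.prop.isFull.isoMk (Sub.Hom.prop f).isIso_θ (Sub.Hom.prop g).isIso_θ i)

variable (hH : Sub.Factors (dflData.{v, u} r) (arrPseudofunctor r))
  (hU : Sub.Factors (finLimData.{v, u} r) (contextPseudofunctor r))
  (hζ : ∀ X : DFLCompCat.{v, u} r,
    CompCat.IsDFLHom (@comprehensionHom X.obj (hasFiniteLimits hU X)))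

/-- The pseudotransformation from `U` followed by `H` to the identity whose component at `X` is
inverse to the comprehension of `X`.  Its naturality constraints are given by identities of
functors of contexts. -/
noncomputable def ζInv : Pseudofunctor.StrongTrans ((U hU).comp (H hH))
    (Pseudofunctor.id (DFLCompCat.{v, u} r)) where
  app X := Sub.Hom.mk (@CompCat.IsDFL.displayHom X.obj (hasFiniteLimits hU X) r X.prop)
    (@CompCat.IsDFL.isDFLHom_displayHom X.obj (hasFiniteLimits hU X) r X.prop)
  naturality {X Y} f := dflIsoMk
    (Functor.rightUnitor (CompCat.Hom.F (Sub.Hom.hom f)) ≪≫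
      (Functor.leftUnitor (CompCat.Hom.F (Sub.Hom.hom f))).symm)
  naturality_naturality {X Y f g} σ := by
    apply dfl_hom₂_ext
    intro x
    let t := (contextTrans σ).app x
    change t ≫ 𝟙 _ ≫ 𝟙 _ = (𝟙 _ ≫ 𝟙 _) ≫ t
    simp
  naturality_id X := by
    apply dfl_hom₂_ext
    intro (x : X.obj.C)
    change (𝟙 x ≫ 𝟙 x) ≫ 𝟙 x = (𝟙 x ≫ 𝟙 x) ≫ 𝟙 x ≫ 𝟙 x
    simp
  naturality_comp {X Y Z} f g := by
    apply dfl_hom₂_ext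
    intro (x : X.obj.C)
    let G := CompCat.Hom.F (Sub.Hom.hom g)
    let z := (CompCat.Hom.F (Sub.Hom.hom f)).obj x
    let y := G.obj z
    change (𝟙 y ≫ 𝟙 y) ≫ 𝟙 y = (𝟙 y ≫ 𝟙 y) ≫ 𝟙 y ≫ (𝟙 y ≫ 𝟙 y) ≫ 𝟙 y ≫ G.map (𝟙 z ≫ 𝟙 z) ≫ 𝟙 y
    rw [Category.comp_id (𝟙 z), CategoryTheory.Functor.map_id]
    change (𝟙 y ≫ 𝟙 y) ≫ 𝟙 y = (𝟙 y ≫ 𝟙 y) ≫ 𝟙 y ≫ (𝟙 y ≫ 𝟙 y) ≫ 𝟙 y ≫ 𝟙 y ≫ 𝟙 y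
    simp only [Category.comp_id]

open scoped Pseudofunctor.StrongTrans

theorem unit_naturality_aux {A : Type u} [Category.{v} A] {y : A} {k : y ⟶ y} (h : k = 𝟙 y) :
    𝟙 y ≫ 𝟙 y ≫ inv (𝟙 y) ≫ 𝟙 y ≫ (𝟙 y ≫ 𝟙 y) ≫ 𝟙 y = (𝟙 y ≫ 𝟙 y) ≫ k := by
  subst h
  simp

/-- The invertible modification from the identity to `ζ` followed by its inverse, given by the
identities of the functors `𝟭 X.C`. -/
noncomputable def ζUnit : 𝟙 (Pseudofunctor.id (DFLCompCat.{v, u} r)) ≅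
    (ζ hH hU hζ : Pseudofunctor.id (DFLCompCat.{v, u} r) ⟶ (U hU).comp (H hH)) ≫ ζInv hH hU :=
  Pseudofunctor.StrongTrans.isoMk
    (fun X => dflIsoMk (Functor.leftUnitor (𝟭 X.obj.C)).symm) (fun {X Y} f => by
      apply dfl_hom₂_ext
      intro (x : X.obj.C)
      let F := CompCat.Hom.F (Sub.Hom.hom f)
      exact unit_naturality_aux (F.map_id x))

theorem counit_naturality_aux {A : Type u} [Category.{v} A] {y : A} {k : y ⟶ y} (h : k = 𝟙 y) :
    𝟙 y ≫ 𝟙 y ≫ 𝟙 y = (𝟙 y ≫ (𝟙 y ≫ 𝟙 y) ≫ 𝟙 y ≫ inv (𝟙 y) ≫ 𝟙 y) ≫ k := by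
  subst h
  simp

/-- The invertible modification from the inverse of `ζ` followed by `ζ` to the identity, given by
the identities of the functors `𝟭 X.C`. -/
noncomputable def ζCounit : @CategoryStruct.comp (DFLCompCat.{v, u} r ⥤ᵖ DFLCompCat.{v, u} r) _
    ((U hU).comp (H hH)) (Pseudofunctor.id _) ((U hU).comp (H hH)) (ζInv hH hU) (ζ hH hU hζ) ≅
      𝟙 ((U hU).comp (H hH)) :=
  Pseudofunctor.StrongTrans.isoMk
    (fun X => dflIsoMk (Functor.leftUnitor (𝟭 X.obj.C))) (fun {X Y} f => by
      apply dfl_hom₂_ext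
      intro (x : X.obj.C)
      let F := CompCat.Hom.F (Sub.Hom.hom f)
      exact counit_naturality_aux (F.map_id x))

end

/-! ### Adjoint equivalences of pseudofunctors -/

section

open scoped Pseudofunctor.StrongTrans

variable {A : Type u₁} [Bicategory.{w₁, v₁} A] {B : Type u₂} [Bicategory.{w₂, v₂} B]

/-- The components of an adjoint equivalence of pseudofunctors are adjoint equivalences. -/
theorem IsAdjointEquivalence.app {F G : A ⥤ᵖ B} {η : F ⟶ G} (h : IsAdjointEquivalence η) (a : A) :
    IsAdjointEquivalence (η.app a) := by
  obtain ⟨e, rfl⟩ := h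
  let evalIso {F G : A ⥤ᵖ B} {η θ : F ⟶ G} (i : η ≅ θ) : η.app a ≅ θ.app a :=
    { hom := i.hom.as.app a
      inv := i.inv.as.app a
      hom_inv_id := congrArg (fun m => m.as.app a) i.hom_inv_id
      inv_hom_id := congrArg (fun m => m.as.app a) i.inv_hom_id }
  exact ⟨Bicategory.Equivalence.mkOfAdjointifyCounit (f := e.hom.app a) (g := e.inv.app a)
    (evalIso e.unit) (evalIso e.counit), rfl⟩

end

section

open scoped Pseudofunctor.StrongTrans

variable {r : UnivalenceReading}

/-! ### The inverse of `ξ` -/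

theorem finLim_hom₂_ext {C C' : FinLim.{v, u} r} {f g : C ⟶ C'} {σ ρ : f ⟶ g}
    (h : ∀ x, (Sub.Hom₂.hom σ).toNatTrans.app x = (Sub.Hom₂.hom ρ).toNatTrans.app x) : σ = ρ :=
  Sub.hom₂_ext <| Cat.Hom₂.ext <| NatTrans.ext <| funext h

variable (hH : Sub.Factors (dflData.{v, u} r) (arrPseudofunctor r))
  (hU : Sub.Factors (finLimData.{v, u} r) (contextPseudofunctor r))

/-- The pseudotransformation from the identity to `H` followed by `U` inverse to `ξ`. -/
def ξInv : Pseudofunctor.StrongTrans (Pseudofunctor.id (FinLim.{v, u} r)) ((H hH).comp (U hU)) where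
  app C := 𝟙 C
  naturality f := (ρ_ f) ≪≫ (λ_ f).symm
  naturality_naturality {C C' f g} σ := by
    apply finLim_hom₂_ext
    intro x
    let t : (Sub.Hom.hom f).toFunctor.obj x ⟶ (Sub.Hom.hom g).toFunctor.obj x :=
      (Sub.Hom₂.hom σ).toNatTrans.app x
    change t ≫ 𝟙 _ ≫ 𝟙 _ = (𝟙 _ ≫ 𝟙 _) ≫ t
    simp
  naturality_id C := by
    apply finLim_hom₂_ext
    intro (x : C.obj)
    change (𝟙 x ≫ 𝟙 x) ≫ 𝟙 x ≫ 𝟙 x = 𝟙 x ≫ 𝟙 x ≫ 𝟙 x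
    simp
  naturality_comp {C C' C''} f g := by
    apply finLim_hom₂_ext
    intro (x : C.obj)
    let z := (Sub.Hom.hom f).toFunctor.obj x
    let y := (Sub.Hom.hom g).toFunctor.obj z
    change (𝟙 y ≫ 𝟙 y) ≫ 𝟙 y ≫ 𝟙 y = 𝟙 y ≫ 𝟙 y ≫ (𝟙 y ≫ 𝟙 y) ≫ 𝟙 y ≫
      (Sub.Hom.hom g).toFunctor.map (𝟙 z ≫ 𝟙 z) ≫ 𝟙 y
    rw [Category.comp_id (𝟙 z), CategoryTheory.Functor.map_id]
    change (𝟙 y ≫ 𝟙 y) ≫ 𝟙 y ≫ 𝟙 y = 𝟙 y ≫ 𝟙 y ≫ (𝟙 y ≫ 𝟙 y) ≫ 𝟙 y ≫ 𝟙 y ≫ 𝟙 y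
    simp only [Category.comp_id]

theorem isAdjointEquivalence_ξ : IsAdjointEquivalence (B := FinLim.{v, u} r ⥤ᵖ FinLim.{v, u} r)
    (a := (H hH).comp (U hU)) (b := Pseudofunctor.id _) (ξ hH hU) := by
  refine ⟨Bicategory.Equivalence.mkOfAdjointifyCounit (B := FinLim.{v, u} r ⥤ᵖ FinLim.{v, u} r)
    (f := ξ hH hU) (g := ξInv hH hU)
    (Pseudofunctor.StrongTrans.isoMk (fun C => (λ_ (𝟙 C)).symm) ?_)
    (Pseudofunctor.StrongTrans.isoMk (fun C => λ_ (𝟙 C)) ?_), rfl⟩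
  · intro C C' f
    apply finLim_hom₂_ext
    intro (x : C.obj)
    let z := (Sub.Hom.hom f).toFunctor.obj x
    change 𝟙 z ≫ 𝟙 z ≫ (𝟙 z ≫ 𝟙 z) ≫ 𝟙 z ≫ (𝟙 z ≫ 𝟙 z) ≫ 𝟙 z =
      (𝟙 z ≫ 𝟙 z) ≫ (Sub.Hom.hom f).toFunctor.map (𝟙 x)
    rw [CategoryTheory.Functor.map_id]
    change 𝟙 z ≫ 𝟙 z ≫ (𝟙 z ≫ 𝟙 z) ≫ 𝟙 z ≫ (𝟙 z ≫ 𝟙 z) ≫ 𝟙 z = (𝟙 z ≫ 𝟙 z) ≫ 𝟙 z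
    simp only [Category.comp_id]
  · intro C C' f
    apply finLim_hom₂_ext
    intro (x : C.obj)
    let z := (Sub.Hom.hom f).toFunctor.obj x
    change 𝟙 z ≫ 𝟙 z ≫ 𝟙 z = (𝟙 z ≫ (𝟙 z ≫ 𝟙 z) ≫ 𝟙 z ≫ (𝟙 z ≫ 𝟙 z) ≫ 𝟙 z) ≫
      (Sub.Hom.hom f).toFunctor.map (𝟙 x)
    rw [CategoryTheory.Functor.map_id]
    change 𝟙 z ≫ 𝟙 z ≫ 𝟙 z = (𝟙 z ≫ (𝟙 z ≫ 𝟙 z) ≫ 𝟙 z ≫ (𝟙 z ≫ 𝟙 z) ≫ 𝟙 z) ≫ 𝟙 z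
    simp only [Category.comp_id]

variable (hζ : ∀ X : DFLCompCat.{v, u} r,
    CompCat.IsDFLHom (@comprehensionHom X.obj (hasFiniteLimits hU X)))

theorem isAdjointEquivalence_ζ :
    IsAdjointEquivalence (B := DFLCompCat.{v, u} r ⥤ᵖ DFLCompCat.{v, u} r)
      (a := Pseudofunctor.id _) (b := (U hU).comp (H hH)) (ζ hH hU hζ) :=
  ⟨Bicategory.Equivalence.mkOfAdjointifyCounit (ζUnit hH hU hζ) (ζCounit hH hU hζ), rfl⟩

end

end DFL

/-- The pseudofunctors `H`, which sends `C` to `id : arr C ⟶ arr C`, and `U`, which takes the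
category of contexts, are well defined, and so is the pseudotransformation `ζ`; with `ξ` they form
a biequivalence between categories with finite limits and DFL comprehension categories, and `ζ` and
`ξ` are pointwise adjoint equivalences. -/
theorem mainTheorem1 (r : DFL.UnivalenceReading) :
    ∃ (hH : DFL.Sub.Factors (DFL.dflData.{v, u} r) (DFL.arrPseudofunctor r))
      (hU : DFL.Sub.Factors (DFL.finLimData.{v, u} r) (DFL.contextPseudofunctor r))
      (hζ : ∀ X : DFL.DFLCompCat.{v, u} r,
        DFL.CompCat.IsDFLHom
          (@DFL.comprehensionHom X.obj (DFL.hasFiniteLimits hU X))),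
      DFL.IsBiequivalence (DFL.H hH) (DFL.U hU) (DFL.ζ hH hU hζ) (DFL.ξ hH hU) ∧
        (∀ X : DFL.DFLCompCat.{v, u} r, DFL.IsAdjointEquivalence ((DFL.ζ hH hU hζ).app X)) ∧
        ∀ C : DFL.FinLim.{v, u} r, DFL.IsAdjointEquivalence ((DFL.ξ hH hU).app C) := by
  have hU := DFL.factors_contextPseudofunctor.{v, u} r
  have hH := DFL.factors_arrPseudofunctor.{v, u} r
  refine ⟨hH, hU, fun X => @DFL.CompCat.IsDFL.isDFLHom_comprehensionHom X.obj
    (DFL.hasFiniteLimits hU X) r X.prop, ?_⟩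
  have h₁ := DFL.isAdjointEquivalence_ζ hH hU fun X =>
    @DFL.CompCat.IsDFL.isDFLHom_comprehensionHom X.obj (DFL.hasFiniteLimits hU X) r X.prop
  have h₂ := DFL.isAdjointEquivalence_ξ hH hU
  exact ⟨⟨h₁, h₂⟩, h₁.app, h₂.app⟩
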